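/- Let $n\ge 3$ and $1\le k\le n-2$ be integers with $\gcd(n,k(k+1))=1$, and let $\zeta=e^{2\pi i/n}$. Let $X_n$ be the Fermat curve $x^n+y^n=z^n$ in the complex projective plane, with automorphisms $\epsilon_0([x:y:z])=[\zeta x:y:z]$ and $\epsilon_1([x:y:z])=[x:\zeta y:z]$, and let $H_{n,k}\subset \mathrm{Aut}(X_n)$ be the subgroup generated by $\epsilon_0\epsilon_1^{-m}$, where $m$ is the inverse of $k$ modulo $n$. Let $W_{n,k}$ be the smooth projective complex curve with affine equation $v^n=u(1-u)^k$. Let $\eta_0$ be its point with $(u,v)=(0,0)$, $\eta_1$ its point with $(u,v)=(1,0)$, and $\eta_\infty$ its point that is not on this affine chart (each of these three points exists and is unique). Then $W_{n,k}$ is the quotient of $X_n$ by $H_{n,k}$, via a map $\pi\colon X_n\to W_{n,k}$ that is given by $u=x^n$ and $v=xy^k$ in the affine coordinates with $z=1$. That is, $\pi$ is surjective, its fibres are the $H_{n,k}$-orbits, $W_{n,k}$ carries the quotient topology (for the Zariski topologies), and the regular functions on an open subset $U\subset W_{n,k}$ are exactly the functions on $U$ whose pullbacks to $\pi^{-1}(U)$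 are regular. Moreover: 1. the fibre of $\pi$ over $\eta_\infty$ is the set of points of $X_n$ with $z=0$, and it has exactly $n$ elements; 2. the fibre of $\pi$ over $\eta_0$ is the set of points of $X_n$ with $z\ne 0$ and $x=0$, and it has exactly $n$ elements; 3. the fibre of $\pi$ over $\eta_1$ is the set of points of $X_n$ with $z\ne 0$ and $y=0$, and it has exactly $n$ elements. -/

import Mathlib

open MvPolynomial (IsHomogeneous)
open scoped LinearAlgebra.Projectivization

noncomputable section

/-! ### Spaces with regular functions

A complex variety in the classical sense: a space of points with its Zariski topology and, for
every open set, the complex valued functions that are regular on it. -/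

/-- A topological space with a sheaf of algebras of complex valued functions. The predicate
`IsRegularOn U f` says that the restriction of `f` to the open set `U` is a regular function; the
values of `f` outside `U` play no role. -/
class SpaceWithFunctions (X : Type*) extends TopologicalSpace X where
  IsRegularOn : Set X → (X → ℂ) → Prop
  congr : ∀ {U : Set X} {f g : X → ℂ}, Set.EqOn f g U → IsRegularOn U f → IsRegularOn U g
  mono : ∀ {U V : Set X} {f : X → ℂ}, IsOpen V → V ⊆ U → IsRegularOn U f → IsRegularOn V f
  glue : ∀ {U : Set X} {f : X → ℂ},
    (∀ P ∈ U, ∃ V, IsOpen V ∧ P ∈ V ∧ V ⊆ U ∧ IsRegularOn V f) → IsRegularOn U f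
  const : ∀ {U : Set X} (c : ℂ), IsOpen U → IsRegularOn U (fun _ => c)
  add : ∀ {U : Set X} {f g : X → ℂ},
    IsRegularOn U f → IsRegularOn U g → IsRegularOn U (fun P => f P + g P)
  mul : ∀ {U : Set X} {f g : X → ℂ},
    IsRegularOn U f → IsRegularOn U g → IsRegularOn U (fun P => f P * g P)

namespace SpaceWithFunctions

/-- A morphism: a continuous map that pulls back regular functions to regular functions. -/
def IsMorphism {X Y : Type*} [SpaceWithFunctions X] [SpaceWithFunctions Y] (φ : X → Y) : Prop :=
  Continuous φ ∧
    ∀ (U : Set Y) (f : Y → ℂ), IsOpen U → IsRegularOn U f → IsRegularOn (φ ⁻¹' U) (f ∘ φ)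

lemma IsMorphism.comp {X Y Z : Type*} [SpaceWithFunctions X] [SpaceWithFunctions Y]
    [SpaceWithFunctions Z] {ψ : Y → Z} {φ : X → Y} (hψ : IsMorphism ψ) (hφ : IsMorphism φ) :
    IsMorphism (ψ ∘ φ) :=
  ⟨hψ.1.comp hφ.1, fun U f hU hf =>
    hφ.2 (ψ ⁻¹' U) (f ∘ ψ) (hU.preimage hψ.1) (hψ.2 U f hU hf)⟩

lemma IsMorphism.id {X : Type*} [SpaceWithFunctions X] : IsMorphism (id : X → X) :=
  ⟨continuous_id, fun _ _ _ hf => hf⟩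

/-- The automorphism group: the bijections that are morphisms together with their inverses. -/
def Aut (X : Type*) [SpaceWithFunctions X] : Subgroup (Equiv.Perm X) where
  carrier := {σ | IsMorphism σ ∧ IsMorphism (σ⁻¹ : Equiv.Perm X)}
  mul_mem' := by
    rintro σ τ ⟨h1, h2⟩ ⟨h3, h4⟩
    refine ⟨h1.comp h3, ?_⟩
    rw [mul_inv_rev]
    exact h4.comp h2
  one_mem' := ⟨IsMorphism.id, by rw [inv_one]; exact IsMorphism.id⟩
  inv_mem' := by
    rintro σ ⟨h1, h2⟩
    exact ⟨h2, by rw [inv_inv]; exact h1⟩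

/-- `π : X → Y` is the quotient of `X` by the group `H` of automorphisms: `π` is surjective, its
fibres are the orbits of `H`, the space `Y` carries the quotient topology, and the regular
functions on an open set `U` of `Y` are the functions whose pullback to `π ⁻¹' U` is regular
(that is, they are the `H`-invariant regular functions on `π ⁻¹' U`). -/
structure IsQuotientBy {X Y : Type*} [SpaceWithFunctions X] [SpaceWithFunctions Y]
    (H : Subgroup (Aut X)) (π : X → Y) : Prop where
  isQuotientMap : Topology.IsQuotientMap π
  eq_iff : ∀ P Q : X, π P = π Q ↔ ∃ σ ∈ H, (σ : Equiv.Perm X) P = Q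
  isRegularOn_iff : ∀ (U : Set Y) (f : Y → ℂ), IsOpen U →
    (IsRegularOn U f ↔ IsRegularOn (π ⁻¹' U) (f ∘ π))

end SpaceWithFunctions

/-! ### The Fermat curve -/

/-- The Fermat curve `x ^ n + y ^ n = z ^ n` in the complex projective plane. -/
structure FermatCurve (n : ℕ) where
  /-- the underlying point `[x : y : z]` of the projective plane -/
  pt : ℙ ℂ (Fin 3 → ℂ)
  eqn : pt.rep 0 ^ n + pt.rep 1 ^ n = pt.rep 2 ^ n

namespace FermatCurve

variable {n : ℕ}

/-- Homogeneous coordinate `x`, for a fixed choice of homogeneous coordinates of each point. -/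
def x (P : FermatCurve n) : ℂ := P.pt.rep 0

/-- Homogeneous coordinate `y`. -/
def y (P : FermatCurve n) : ℂ := P.pt.rep 1

/-- Homogeneous coordinate `z`. -/
def z (P : FermatCurve n) : ℂ := P.pt.rep 2

/-- The Zariski topology, generated by the non-vanishing loci of homogeneous polynomials. -/
instance : TopologicalSpace (FermatCurve n) :=
  TopologicalSpace.generateFrom
    {s | ∃ (d : ℕ) (p : MvPolynomial (Fin 3) ℂ), p.IsHomogeneous d ∧
      s = {P : FermatCurve n | p.eval P.pt.rep ≠ 0}}

/-- A function is regular on `U` if around each point of `U` it is a quotient of two homogeneous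
polynomials of the same degree, with non-vanishing denominator. -/
def IsRegularOn (U : Set (FermatCurve n)) (f : FermatCurve n → ℂ) : Prop :=
  ∀ P ∈ U, ∃ V : Set (FermatCurve n), IsOpen V ∧ P ∈ V ∧ V ⊆ U ∧
    ∃ (d : ℕ) (p q : MvPolynomial (Fin 3) ℂ), p.IsHomogeneous d ∧ q.IsHomogeneous d ∧
      ∀ Q ∈ V, q.eval Q.pt.rep ≠ 0 ∧ f Q = p.eval Q.pt.rep / q.eval Q.pt.rep

instance : SpaceWithFunctions (FermatCurve n) where
  IsRegularOn := IsRegularOn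
  congr := by
    intro U f g h hf P hP
    obtain ⟨V, h1, h2, h3, d, p, q, hp, hq, h4⟩ := hf P hP
    exact ⟨V, h1, h2, h3, d, p, q, hp, hq, fun Q hQ => ⟨(h4 Q hQ).1, by
      rw [← h (h3 hQ)]; exact (h4 Q hQ).2⟩⟩
  mono := by
    intro U V f hV hVU hf P hP
    obtain ⟨V', h1, h2, h3, d, p, q, hp, hq, h4⟩ := hf P (hVU hP)
    exact ⟨V' ∩ V, h1.inter hV, ⟨h2, hP⟩, Set.inter_subset_right, d, p, q, hp, hq,
      fun Q hQ => h4 Q hQ.1⟩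
  glue := by
    intro U f h P hP
    obtain ⟨V, _, h2, h3, h4⟩ := h P hP
    obtain ⟨V', h5, h6, h7, h8⟩ := h4 P h2
    exact ⟨V', h5, h6, h7.trans h3, h8⟩
  const := by
    intro U c hU P hP
    exact ⟨U, hU, hP, subset_rfl, 0, MvPolynomial.C c, 1, MvPolynomial.isHomogeneous_C _ _,
      MvPolynomial.isHomogeneous_one _ _, fun Q _ => by simp⟩
  add := by
    intro U f g hf hg P hP
    obtain ⟨V, h1, h2, h3, d, p, q, hp, hq, h4⟩ := hf P hP
    obtain ⟨V', h1', h2', _, d', p', q', hp', hq', h4'⟩ := hg P hP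
    refine ⟨V ∩ V', h1.inter h1', ⟨h2, h2'⟩, fun Q hQ => h3 hQ.1, d + d', p * q' + q * p',
      q * q', (hp.mul hq').add (hq.mul hp'), hq.mul hq', fun Q hQ => ?_⟩
    obtain ⟨a, b⟩ := h4 Q hQ.1
    obtain ⟨a', b'⟩ := h4' Q hQ.2
    refine ⟨by simpa using ⟨a, a'⟩, ?_⟩
    simp only [b, b', map_add, map_mul]
    rw [div_add_div _ _ a a']
  mul := by
    intro U f g hf hg P hP
    obtain ⟨V, h1, h2, h3, d, p, q, hp, hq, h4⟩ := hf P hP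
    obtain ⟨V', h1', h2', _, d', p', q', hp', hq', h4'⟩ := hg P hP
    refine ⟨V ∩ V', h1.inter h1', ⟨h2, h2'⟩, fun Q hQ => h3 hQ.1, d + d', p * p',
      q * q', hp.mul hp', hq.mul hq', fun Q hQ => ?_⟩
    obtain ⟨a, b⟩ := h4 Q hQ.1
    obtain ⟨a', b'⟩ := h4' Q hQ.2
    refine ⟨by simpa using ⟨a, a'⟩, ?_⟩
    simp only [b, b', map_mul]
    rw [div_mul_div_comm]

/-- The linear automorphism `(x, y, z) ↦ (a₀ x, a₁ y, a₂ z)` of `ℂ ^ 3`. -/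
def diag (a : Fin 3 → ℂˣ) : (Fin 3 → ℂ) ≃ₗ[ℂ] (Fin 3 → ℂ) :=
  LinearEquiv.piCongrRight fun i => LinearEquiv.smulOfUnit (a i)

lemma diag_apply (a : Fin 3 → ℂˣ) (v : Fin 3 → ℂ) (i : Fin 3) : diag a v i = a i * v i := rfl

lemma exists_rep_map_diag (a : Fin 3 → ℂˣ) (P : ℙ ℂ (Fin 3 → ℂ)) :
    ∃ t : ℂˣ, (P.map (diag a).toLinearMap (diag a).injective).rep =
      fun i => (t : ℂ) * (a i * P.rep i) := by
  have hne : diag a P.rep ≠ 0 := by simpa using P.rep_nonzero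
  have h : P.map (diag a).toLinearMap (diag a).injective =
      Projectivization.mk ℂ (diag a P.rep) hne := by
    conv_lhs => rw [← P.mk_rep]
    rfl
  obtain ⟨t, ht⟩ := Projectivization.exists_smul_eq_mk_rep ℂ (diag a P.rep) hne
  refine ⟨t, ?_⟩
  rw [h, ← ht]
  rfl

/-- The map `[x : y : z] ↦ [a₀ x : a₁ y : a₂ z]` of the Fermat curve, for `n`-th roots of
unity `a₀, a₁, a₂`. -/
def scale (a : Fin 3 → ℂˣ) (ha : ∀ i, a i ^ n = 1) (P : FermatCurve n) : FermatCurve n where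
  pt := P.pt.map (diag a).toLinearMap (diag a).injective
  eqn := by
    obtain ⟨t, ht⟩ := exists_rep_map_diag a P.pt
    have ha' : ∀ i, (a i : ℂ) ^ n = 1 := fun i => by
      rw [← Units.val_pow_eq_pow_val, ha, Units.val_one]
    simp only [ht, mul_pow, ha', one_mul]
    rw [← mul_add, P.eqn]

lemma eval_mul_of_isHomogeneous {d : ℕ} {p : MvPolynomial (Fin 3) ℂ} (hp : p.IsHomogeneous d)
    (t : ℂ) (w : Fin 3 → ℂ) : p.eval (fun i => t * w i) = t ^ d * p.eval w := by
  rw [MvPolynomial.eval_eq', MvPolynomial.eval_eq', Finset.mul_sum]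
  refine Finset.sum_congr rfl fun m hm => ?_
  have h : ∑ i, m i = d := by
    rw [← hp (MvPolynomial.mem_support_iff.1 hm), Finsupp.weight_apply,
      Finsupp.sum_fintype _ _ (by simp)]
    simp
  simp_rw [mul_pow]
  rw [Finset.prod_mul_distrib, Finset.prod_pow_eq_pow_sum, h]
  ring

lemma eval_scale {a : Fin 3 → ℂˣ} {ha : ∀ i, a i ^ n = 1} (P : FermatCurve n) :
    ∃ t : ℂ, t ≠ 0 ∧ ∀ (d : ℕ) (p : MvPolynomial (Fin 3) ℂ), p.IsHomogeneous d →
      p.eval (scale a ha P).pt.rep = t ^ d * (MvPolynomial.aeval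
        (fun i => MvPolynomial.C (a i : ℂ) * MvPolynomial.X i) p).eval P.pt.rep := by
  obtain ⟨t, ht⟩ := exists_rep_map_diag a P.pt
  refine ⟨t, t.ne_zero, fun d p hp => ?_⟩
  have h1 : (scale a ha P).pt.rep = fun i => (t : ℂ) * (a i * P.pt.rep i) := ht
  have h2 : (MvPolynomial.aeval (fun i => MvPolynomial.C (a i : ℂ) * MvPolynomial.X i) p).eval
      P.pt.rep = p.eval (fun i => a i * P.pt.rep i) := by
    clear hp
    induction p using MvPolynomial.induction_on with
    | C c => simp
    | add p q hp hq => rw [map_add, map_add, map_add, hp, hq]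
    | mul_X p i hp => rw [map_mul, map_mul, map_mul, hp]; simp
  rw [h1, h2]
  exact eval_mul_of_isHomogeneous hp _ _

lemma isHomogeneous_bind {a : Fin 3 → ℂˣ} {d : ℕ} {p : MvPolynomial (Fin 3) ℂ}
    (hp : p.IsHomogeneous d) : (MvPolynomial.aeval
        (fun i => MvPolynomial.C (a i : ℂ) * MvPolynomial.X i) p).IsHomogeneous d := by
  have h := hp.aeval (S := ℂ) (n := 1)
    (fun i => MvPolynomial.C (a i : ℂ) * MvPolynomial.X (R := ℂ) i) (fun i => by
      simpa using (MvPolynomial.isHomogeneous_C (Fin 3) (a i : ℂ)).mul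
        (MvPolynomial.isHomogeneous_X ℂ i))
  rwa [one_mul] at h

lemma isMorphism_scale (a : Fin 3 → ℂˣ) (ha : ∀ i, a i ^ n = 1) :
    SpaceWithFunctions.IsMorphism (scale (n := n) a ha) := by
  have hc : Continuous (scale (n := n) a ha) := by
    refine continuous_generateFrom_iff.2 ?_
    rintro _ ⟨d, p, hp, rfl⟩
    refine TopologicalSpace.isOpen_generateFrom_of_mem ⟨d, _, isHomogeneous_bind (a := a) hp, ?_⟩
    ext P
    obtain ⟨t, ht, h⟩ := eval_scale (a := a) (ha := ha) P
    simp [h d p hp, ht]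
  refine ⟨hc, fun U f hU hf P hP => ?_⟩
  obtain ⟨V, h1, h2, h3, d, p, q, hp, hq, h4⟩ := hf _ hP
  refine ⟨_, h1.preimage hc, h2, fun Q hQ => h3 hQ, d, _, _, isHomogeneous_bind (a := a) hp,
    isHomogeneous_bind (a := a) hq, fun Q hQ => ?_⟩
  obtain ⟨t, ht, h⟩ := eval_scale (a := a) (ha := ha) Q
  obtain ⟨h5, h6⟩ := h4 _ hQ
  rw [h d q hq] at h5
  refine ⟨right_ne_zero_of_mul h5, ?_⟩
  rw [Function.comp_apply, h6, h d p hp, h d q hq, mul_div_mul_left _ _ (pow_ne_zero _ ht)]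

lemma scale_scale {a b : Fin 3 → ℂˣ} {ha : ∀ i, a i ^ n = 1} {hb : ∀ i, b i ^ n = 1}
    (hab : ∀ i, a i * b i = 1) (P : FermatCurve n) : scale a ha (scale b hb P) = P := by
  obtain ⟨p, hp⟩ := P
  have h : (p.map (diag b).toLinearMap (diag b).injective).map
      (diag a).toLinearMap (diag a).injective = p := by
    induction p using Projectivization.ind with
    | h w hw =>
      rw [Projectivization.map_mk, Projectivization.map_mk, Projectivization.mk_eq_mk_iff']
      refine ⟨1, ?_⟩
      ext i
      have h1 : (a i : ℂ) * b i = 1 := by rw [← Units.val_mul, hab, Units.val_one]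
      change (1 : ℂ) * w i = a i * (b i * w i)
      rw [← mul_assoc, h1]
  simp only [scale, h]

/-- `scale a`, as an automorphism of the Fermat curve. -/
def scaleAut (a : Fin 3 → ℂˣ) (ha : ∀ i, a i ^ n = 1) : SpaceWithFunctions.Aut (FermatCurve n) :=
  have hb : ∀ i, (a i)⁻¹ ^ n = 1 := fun i => by rw [inv_pow, ha, inv_one]
  ⟨{ toFun := scale a ha
     invFun := scale (fun i => (a i)⁻¹) hb
     left_inv := scale_scale fun i => inv_mul_cancel (a i)
     right_inv := scale_scale fun i => mul_inv_cancel (a i) },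
    isMorphism_scale a ha, isMorphism_scale _ hb⟩

/-- The root of unity `ζ = exp (2 π i / n)`, as a unit of `ℂ`. -/
def zeta (n : ℕ) : ℂˣ :=
  Units.mk0 (Complex.exp (2 * Real.pi * Complex.I / n)) (Complex.exp_ne_zero _)

lemma zeta_pow (n : ℕ) [NeZero n] : zeta n ^ n = 1 := by
  ext
  exact (Complex.isPrimitiveRoot_exp n (NeZero.ne n)).pow_eq_one

/-- The automorphism `ε₀ : [x : y : z] ↦ [ζ x : y : z]`. -/
def ε₀ (n : ℕ) [NeZero n] : SpaceWithFunctions.Aut (FermatCurve n) :=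
  scaleAut ![zeta n, 1, 1] (by intro i; fin_cases i <;> simp [zeta_pow])

/-- The automorphism `ε₁ : [x : y : z] ↦ [x : ζ y : z]`. -/
def ε₁ (n : ℕ) [NeZero n] : SpaceWithFunctions.Aut (FermatCurve n) :=
  scaleAut ![1, zeta n, 1] (by intro i; fin_cases i <;> simp [zeta_pow])

/-- The group generated by `ε₀ ε₁ ^ (-k⁻¹)`, where `k⁻¹` is the inverse of `k` modulo `n`. -/
def H (n k : ℕ) [NeZero n] : Subgroup (SpaceWithFunctions.Aut (FermatCurve n)) :=
  Subgroup.zpowers (ε₀ n * ε₁ n ^ (-((k : ZMod n)⁻¹.val : ℤ)))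

end FermatCurve

/-! ### The cyclic Belyi curve -/

namespace CyclicBelyi

open Polynomial

/-- The polynomial `v ^ n - u (1 - u) ^ k` in `ℂ[u][v]`. -/
def poly (n k : ℕ) : ℂ[X][X] := X ^ n - C (X * (1 - X) ^ k)

lemma irreducible_poly (n k : ℕ) [NeZero n] : Irreducible (poly n k) := by
  have hn : n ≠ 0 := NeZero.ne n
  have hm : (poly n k).Monic := monic_X_pow_sub_C _ hn
  have hd : (poly n k).natDegree = n := natDegree_X_pow_sub_C
  have hP : (Ideal.span {(X : ℂ[X])}).IsPrime :=
    (Ideal.span_singleton_prime X_ne_zero).2 prime_X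
  refine irreducible_of_eisenstein_criterion hP ?_ ?_ ?_ ?_ hm.isPrimitive
  · rw [hm.leadingCoeff]
    exact (Ideal.ne_top_iff_one _).1 hP.ne_top
  · intro m hmn
    rw [degree_eq_natDegree hm.ne_zero, hd, Nat.cast_lt] at hmn
    rw [poly, coeff_sub, coeff_X_pow, if_neg hmn.ne, coeff_C, zero_sub]
    split_ifs
    · exact neg_mem (Ideal.mul_mem_right _ _ (Ideal.mem_span_singleton_self _))
    · simp
  · rw [← natDegree_pos_iff_degree_pos, hd]
    exact Nat.pos_of_ne_zero hn
  · rw [poly, coeff_sub, coeff_X_pow, if_neg (Ne.symm hn), coeff_C_zero, zero_sub, neg_mem_iff,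
      Ideal.span_singleton_pow, Ideal.mem_span_singleton, sq]
    intro h
    have h1 := (mul_dvd_mul_iff_left (X_ne_zero (R := ℂ))).1 h
    rw [X_dvd_iff, coeff_zero_eq_eval_zero] at h1
    simp at h1

/-- The coordinate ring `ℂ[u, v] / (v ^ n - u (1 - u) ^ k)` of the affine curve
`v ^ n = u (1 - u) ^ k`. -/
abbrev CoordinateRing (n k : ℕ) : Type := AdjoinRoot (poly n k)

instance (n k : ℕ) [NeZero n] : IsDomain (CoordinateRing n k) :=
  AdjoinRoot.isDomain_of_prime (irreducible_poly n k).prime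

/-- The function field of the affine curve `v ^ n = u (1 - u) ^ k`. -/
abbrev FunctionField (n k : ℕ) : Type := FractionRing (CoordinateRing n k)

/-- The function `u`. -/
def u (n k : ℕ) : FunctionField n k :=
  algebraMap (CoordinateRing n k) _ (AdjoinRoot.of (poly n k) X)

/-- The function `v`. -/
def v (n k : ℕ) : FunctionField n k :=
  algebraMap (CoordinateRing n k) _ (AdjoinRoot.root (poly n k))

end CyclicBelyi

open CyclicBelyi in
/-- The cyclic Belyi curve `W_{n,k}`: the smooth projective curve over `ℂ` with affine equation
`v ^ n = u (1 - u) ^ k`. It is the complete non-singular curve attached to the function field `K`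
of the affine curve: its points are the places of `K / ℂ`, that is, the valuation rings of `K`
that contain `ℂ` and are different from `K`; the valuation ring is the local ring of the curve
at the point. -/
structure CyclicBelyiCurve (n k : ℕ) [NeZero n] where
  /-- the local ring at the point -/
  localRing : ValuationSubring (FunctionField n k)
  const_mem : ∀ c : ℂ, algebraMap ℂ (FunctionField n k) c ∈ localRing
  ne_top : localRing ≠ ⊤

namespace CyclicBelyiCurve

open CyclicBelyi

variable {n k : ℕ} [NeZero n]

/-- The rational function `φ` is regular at the point `P`, with value `c`: the difference `φ - c`
lies in the maximal ideal of the local ring at `P`. -/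
def HasValueAt (P : CyclicBelyiCurve n k) (φ : FunctionField n k) (c : ℂ) : Prop :=
  φ - algebraMap ℂ (FunctionField n k) c ∈ P.localRing.nonunits

/-- The point lies on the affine chart: the functions `u` and `v` are both regular there. -/
def OnAffineChart (P : CyclicBelyiCurve n k) : Prop :=
  u n k ∈ P.localRing ∧ v n k ∈ P.localRing

/-- The Zariski topology of a curve: the non-empty open sets are the complements of finite
sets. -/
instance : TopologicalSpace (CyclicBelyiCurve n k) where
  IsOpen U := U.Nonempty → Uᶜ.Finite
  isOpen_univ := by simp
  isOpen_inter := by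
    rintro s t hs ht ⟨P, hP⟩
    rw [Set.compl_inter]
    exact (hs ⟨P, hP.1⟩).union (ht ⟨P, hP.2⟩)
  isOpen_sUnion := by
    rintro S hS ⟨P, s, hs, hP⟩
    exact (hS s hs ⟨P, hP⟩).subset (Set.compl_subset_compl.2 (Set.subset_sUnion_of_mem hs))

/-- A function is regular on `U` if around each point of `U` it is given by the values of a
rational function that is regular there. -/
def IsRegularOn (U : Set (CyclicBelyiCurve n k)) (f : CyclicBelyiCurve n k → ℂ) : Prop :=
  ∀ P ∈ U, ∃ V : Set (CyclicBelyiCurve n k), IsOpen V ∧ P ∈ V ∧ V ⊆ U ∧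
    ∃ φ : FunctionField n k, ∀ Q ∈ V, Q.HasValueAt φ (f Q)

lemma HasValueAt.add {P : CyclicBelyiCurve n k} {φ ψ : FunctionField n k} {c d : ℂ}
    (h : P.HasValueAt φ c) (h' : P.HasValueAt ψ d) : P.HasValueAt (φ + ψ) (c + d) := by
  unfold HasValueAt at *
  have := P.localRing.nonunits.add_mem h h'
  rw [map_add]
  convert this using 1
  ring

lemma HasValueAt.mem {P : CyclicBelyiCurve n k} {φ : FunctionField n k} {c : ℂ}
    (h : P.HasValueAt φ c) : φ ∈ P.localRing := by
  have := P.localRing.add_mem _ _ (P.localRing.nonunits_subset h) (P.const_mem c)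
  simpa using this

lemma HasValueAt.mul {P : CyclicBelyiCurve n k} {φ ψ : FunctionField n k} {c d : ℂ}
    (h : P.HasValueAt φ c) (h' : P.HasValueAt ψ d) : P.HasValueAt (φ * ψ) (c * d) := by
  have key : ∀ {a b : FunctionField n k}, a ∈ P.localRing → b ∈ P.localRing.nonunits →
      a * b ∈ P.localRing.nonunits := by
    intro a b ha hb
    rw [ValuationSubring.mem_nonunits_iff] at *
    rw [map_mul]
    exact mul_lt_one_of_nonneg_of_lt_one_right ((P.localRing.valuation_le_one_iff a).2 ha) zero_le hb
  have := P.localRing.nonunits.add_mem (key h.mem h') (key (P.const_mem d) h)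
  unfold HasValueAt
  rw [map_mul]
  convert this using 1
  ring

instance : SpaceWithFunctions (CyclicBelyiCurve n k) where
  IsRegularOn := IsRegularOn
  congr := by
    intro U f g h hf P hP
    obtain ⟨V, h1, h2, h3, φ, h4⟩ := hf P hP
    exact ⟨V, h1, h2, h3, φ, fun Q hQ => h (h3 hQ) ▸ h4 Q hQ⟩
  mono := by
    intro U V f hV hVU hf P hP
    obtain ⟨V', h1, h2, h3, φ, h4⟩ := hf P (hVU hP)
    exact ⟨V' ∩ V, h1.inter hV, ⟨h2, hP⟩, Set.inter_subset_right, φ, fun Q hQ => h4 Q hQ.1⟩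
  glue := by
    intro U f h P hP
    obtain ⟨V, _, h2, h3, h4⟩ := h P hP
    obtain ⟨V', h5, h6, h7, h8⟩ := h4 P h2
    exact ⟨V', h5, h6, h7.trans h3, h8⟩
  const := by
    intro U c hU P hP
    refine ⟨U, hU, hP, subset_rfl, algebraMap ℂ _ c, fun Q _ => ?_⟩
    unfold HasValueAt
    rw [sub_self]
    exact Q.localRing.nonunits.zero_mem
  add := by
    intro U f g hf hg P hP
    obtain ⟨V, h1, h2, h3, φ, h4⟩ := hf P hP
    obtain ⟨V', h1', h2', _, φ', h4'⟩ := hg P hP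
    exact ⟨V ∩ V', h1.inter h1', ⟨h2, h2'⟩, fun Q hQ => h3 hQ.1, φ + φ',
      fun Q hQ => (h4 Q hQ.1).add (h4' Q hQ.2)⟩
  mul := by
    intro U f g hf hg P hP
    obtain ⟨V, h1, h2, h3, φ, h4⟩ := hf P hP
    obtain ⟨V', h1', h2', _, φ', h4'⟩ := hg P hP
    exact ⟨V ∩ V', h1.inter h1', ⟨h2, h2'⟩, fun Q hQ => h3 hQ.1, φ * φ',
      fun Q hQ => (h4 Q hQ.1).mul (h4' Q hQ.2)⟩

end CyclicBelyiCurve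

end

/-! Points of `W_{n,k}` are places of K = ℂ(u, v), so the argument takes place in function fields.
Let L = ℂ(x, y) with x^n + y^n = 1. Since 1 - x^n = y^n, the assignment u ↦ x^n, v ↦ x y^k embeds K
in L (`belyiMap`), and π (`toBelyi`) sends a point P to the intersection of its local ring with K.
That local ring is a valuation ring because the Fermat curve is smooth (`isRegularPoint`,
`IsRegularPoint.value_or_inv_value`). Conversely, every place of L over ℂ comes from a point
(`exists_place_eq`). As places of K extend to L, π is surjective.

The fibres are read off from the values of u and v. In the affine chart, equality of u gives
equality of the y^n. If y ≠ 0, let ω be the ratio of the two y-coordinates; equality of v then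
forces the x-coordinates to differ by ω^(-k). The maps (x, y) ↦ (ω^(-k) x, ω y) with ω^n = 1 are
precisely the elements of `H n k` (`exists_mem_H_iff`). On y = 0 one must extract a k-th root among
the n-th roots of unity, and on z = 0, where the ratio y/x is multiplied by ω^(k+1), a (k+1)-th
root; this is where gcd(n, k(k+1)) = 1 enters. Hence each of x = 0, y = 0 (in the chart) and z = 0
is a single orbit, parametrized by the n-th roots of 1 or of -1.

Both topologies are cofinite and the fibres of π are finite, so π is a topological quotient map. If
f ∘ π is regular, it is locally given by an element a of L. The function a agrees with its transform
under the group at all but finitely many points, so a is invariant (`twist_eq_self_of_hasValueAt`).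
Averaging over the group shows that the invariants of L are K (`mem_range_belyiMap_of_invariant`),
so a descends and represents f. -/

noncomputable section

/-! ### Local rings of points on a curve inside a function field -/

section LocalRings

open MvPolynomial

variable {L : Type} [Field L] [Algebra ℂ L] {w : Fin 3 → L} {a : Fin 3 → ℂ}

/-- The element `f` is a quotient of polynomials in the coordinate functions `w` whose denominator
does not vanish at the point with coordinates `a`, and its value at this point is `c`. -/
def PointValue (w : Fin 3 → L) (a : Fin 3 → ℂ) (f : L) (c : ℂ) : Prop :=
  ∃ p q : MvPolynomial (Fin 3) ℂ, eval a q ≠ 0 ∧ f * aeval w q = aeval w p ∧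
    c * eval a q = eval a p

/-- The values `a` are compatible with all the relations between the functions `w`. -/
def IsSpecialization (w : Fin 3 → L) (a : Fin 3 → ℂ) : Prop :=
  ∀ p : MvPolynomial (Fin 3) ℂ, aeval w p = 0 → eval a p = 0

/-- The functions `w` generate the field `L`, the point `a` satisfies their relations, and its
maximal ideal is generated by a single function `t`. -/
structure IsRegularPoint (w : Fin 3 → L) (a : Fin 3 → ℂ) (t : L) : Prop where
  spec : IsSpecialization w a
  frac : ∀ f : L, ∃ p q : MvPolynomial (Fin 3) ℂ, aeval w q ≠ 0 ∧ f * aeval w q = aeval w p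
  value_zero : PointValue w a t 0
  unif : ∀ i, ∃ g c, PointValue w a g c ∧ w i - algebraMap ℂ L (a i) = t * g

namespace PointValue

variable {f g : L} {c d : ℂ}

lemma of_aeval (p : MvPolynomial (Fin 3) ℂ) : PointValue w a (aeval w p) (eval a p) :=
  ⟨p, 1, by simp, by simp, by simp⟩

lemma const (c : ℂ) : PointValue w a (algebraMap ℂ L c) c := by
  simpa using of_aeval (w := w) (a := a) (C c)

lemma coord (i : Fin 3) : PointValue w a (w i) (a i) := by
  simpa using of_aeval (w := w) (a := a) (X i)

lemma add (hf : PointValue w a f c) (hg : PointValue w a g d) :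
    PointValue w a (f + g) (c + d) := by
  obtain ⟨p, q, h1, h2, h3⟩ := hf
  obtain ⟨p', q', h1', h2', h3'⟩ := hg
  refine ⟨p * q' + p' * q, q * q', by simp [h1, h1'], ?_, ?_⟩
  · simp only [map_add, map_mul, ← h2, ← h2']; ring
  · simp only [map_add, map_mul, ← h3, ← h3']; ring

lemma mul (hf : PointValue w a f c) (hg : PointValue w a g d) :
    PointValue w a (f * g) (c * d) := by
  obtain ⟨p, q, h1, h2, h3⟩ := hf
  obtain ⟨p', q', h1', h2', h3'⟩ := hg
  refine ⟨p * p', q * q', by simp [h1, h1'], ?_, ?_⟩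
  · simp only [map_mul, ← h2, ← h2']; ring
  · simp only [map_mul, ← h3, ← h3']; ring

lemma neg (hf : PointValue w a f c) : PointValue w a (-f) (-c) := by
  simpa using (const (-1)).mul hf

lemma sub (hf : PointValue w a f c) (hg : PointValue w a g d) :
    PointValue w a (f - g) (c - d) := by
  simpa [sub_eq_add_neg] using hf.add hg.neg

lemma pow (hf : PointValue w a f c) (e : ℕ) : PointValue w a (f ^ e) (c ^ e) := by
  induction e with
  | zero => simpa using const (w := w) (a := a) 1
  | succ e ih => simpa [pow_succ] using ih.mul hf

lemma sum {ι : Type*} (s : Finset ι) {f : ι → L} {c : ι → ℂ}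
    (h : ∀ i ∈ s, PointValue w a (f i) (c i)) :
    PointValue w a (∑ i ∈ s, f i) (∑ i ∈ s, c i) := by
  classical
  induction s using Finset.induction_on with
  | empty => simpa using const (w := w) (a := a) 0
  | insert i s hi ih =>
    rw [Finset.sum_insert hi, Finset.sum_insert hi]
    exact (h i (Finset.mem_insert_self i s)).add
      (ih fun j hj => h j (Finset.mem_insert_of_mem hj))

lemma unique (hs : IsSpecialization w a) (hf : PointValue w a f c) (hf' : PointValue w a f d) :
    c = d := by
  obtain ⟨p, q, h1, h2, h3⟩ := hf
  obtain ⟨p', q', h1', h2', h3'⟩ := hf'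
  have h := hs (p * q' - p' * q) (by simp only [map_sub, map_mul, ← h2, ← h2']; ring)
  simp only [map_sub, map_mul, ← h3, ← h3'] at h
  have h4 : (c - d) * (eval a q * eval a q') = 0 := by linear_combination h
  have h5 := (mul_eq_zero.1 h4).resolve_right (mul_ne_zero h1 h1')
  exact sub_eq_zero.1 h5

lemma inv (hs : IsSpecialization w a) (hf : PointValue w a f c) (hc : c ≠ 0) :
    PointValue w a f⁻¹ c⁻¹ := by
  have hf0 : f ≠ 0 := by
    rintro rfl
    exact hc (hf.unique hs (by simpa using const (w := w) (a := a) 0))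
  obtain ⟨p, q, h1, h2, h3⟩ := hf
  refine ⟨q, p, by rw [← h3]; exact mul_ne_zero hc h1, ?_, ?_⟩
  · rw [← h2, inv_mul_cancel_left₀ hf0]
  · rw [← h3, inv_mul_cancel_left₀ hc]

end PointValue

namespace IsRegularPoint

variable {t : L} (h : IsRegularPoint w a t)
include h

/-- Divisibility by t passes from the coordinates to all polynomials by the product rule p X_i -
p(a) a_i = (p - p(a)) X_i + p(a) (X_i - a_i). -/
lemma aeval_sub_eval (p : MvPolynomial (Fin 3) ℂ) :
    ∃ g c, PointValue w a g c ∧ aeval w p - algebraMap ℂ L (eval a p) = t * g := by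
  induction p using MvPolynomial.induction_on with
  | C c => exact ⟨_, _, PointValue.const 0, by simp⟩
  | add p q hp hq =>
    obtain ⟨g, c, h1, h2⟩ := hp
    obtain ⟨g', c', h1', h2'⟩ := hq
    exact ⟨_, _, h1.add h1', by simp only [map_add]; linear_combination h2 + h2'⟩
  | mul_X p i hp =>
    obtain ⟨g, c, h1, h2⟩ := hp
    obtain ⟨g', c', h1', h2'⟩ := h.unif i
    refine ⟨_, _, (h1.mul (.coord i)).add ((PointValue.const (eval a p)).mul h1'), ?_⟩
    simp only [map_mul, aeval_X, eval_X]
    linear_combination w i * h2 + algebraMap ℂ L (eval a p) * h2'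

lemma eq_mul_of_value_zero {f : L} (hf : PointValue w a f 0) :
    ∃ g c, PointValue w a g c ∧ f = t * g := by
  obtain ⟨p, q, h1, h2, h3⟩ := hf
  obtain ⟨g, c, h4, h5⟩ := h.aeval_sub_eval p
  have hq : aeval w q ≠ 0 := fun h0 => h1 (h.spec q h0)
  refine ⟨_, _, h4.mul ((PointValue.of_aeval q).inv h.spec h1), ?_⟩
  rw [← h3] at h5
  simp only [zero_mul, map_zero, sub_zero] at h5
  rw [← mul_assoc, ← h5, ← h2, mul_inv_cancel_right₀ hq]

/-- A nonzero function cannot be divisible by every power of t. This is Krull's intersection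
argument, run with ideals of the polynomial ring so that only its noetherianity is needed. -/
lemma exists_eq_pow_mul {f : L} (hf : f ≠ 0) {c : ℂ} (hfc : PointValue w a f c) :
    ∃ e g d, d ≠ 0 ∧ PointValue w a g d ∧ f = t ^ e * g := by
  by_contra hcon
  have key : ∀ e, ∃ g c, PointValue w a g c ∧ f = t ^ e * g := by
    intro e
    induction e with
    | zero => exact ⟨f, c, hfc, by simp⟩
    | succ e ih =>
      obtain ⟨g, d, h1, h2⟩ := ih
      have hd : d = 0 := by
        by_contra hd
        exact hcon ⟨e, g, d, hd, h1, h2⟩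
      subst hd
      obtain ⟨g', d', h3, h4⟩ := h.eq_mul_of_value_zero h1
      exact ⟨g', d', h3, by rw [h2, h4]; ring⟩
  choose g d hg hfg using key
  have ht : t ≠ 0 := by
    rintro rfl
    exact hf (by rw [hfg 1]; simp)
  have hstep : ∀ e, g e = t * g (e + 1) := fun e => by
    refine mul_left_cancel₀ (pow_ne_zero e ht) ?_
    rw [← hfg e, ← mul_assoc, ← pow_succ, ← hfg (e + 1)]
  -- J e consists of the polynomials whose image lies in g_e times the local ring. The chain
  -- increases because g_e = t g_(e+1).
  let J : ℕ → Ideal (MvPolynomial (Fin 3) ℂ) := fun e =>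
    { carrier := {b | ∃ o c, PointValue w a o c ∧ aeval w b = g e * o}
      add_mem' := by
        rintro b b' ⟨o, c, h1, h2⟩ ⟨o', c', h1', h2'⟩
        exact ⟨_, _, h1.add h1', by rw [map_add, h2, h2', mul_add]⟩
      zero_mem' := ⟨_, _, PointValue.const 0, by simp⟩
      smul_mem' := by
        rintro r b ⟨o, c, h1, h2⟩
        exact ⟨_, _, (PointValue.of_aeval r).mul h1, by rw [smul_eq_mul, map_mul, h2]; ring⟩ }
  have hJ : Monotone J := by
    refine monotone_nat_of_le_succ fun e => ?_
    rintro b ⟨o, c, h1, h2⟩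
    exact ⟨_, _, h.value_zero.mul h1, by rw [h2, hstep e]; ring⟩
  obtain ⟨e, he⟩ := monotone_stabilizes_iff_noetherian.2
    (inferInstance : IsNoetherian (MvPolynomial (Fin 3) ℂ) (MvPolynomial (Fin 3) ℂ)) ⟨J, hJ⟩
  obtain ⟨p, q, h1, h2, -⟩ := hg (e + 1)
  have hp : p ∈ J (e + 1) := ⟨_, _, PointValue.of_aeval q, h2.symm⟩
  have hJe : J e = J (e + 1) := he (e + 1) (Nat.le_succ e)
  rw [← hJe] at hp
  obtain ⟨o, c, h3, h4⟩ := hp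
  have hg0 : g (e + 1) ≠ 0 := fun h0 => hf (by rw [hfg (e + 1), h0, mul_zero])
  -- Stability of the chain puts the numerator p of g_(e+1) = p/q in g_e O = t g_(e+1) O. Cancelling
  -- g_(e+1) makes q divisible by t, although q does not vanish at a.
  have hq : aeval w q = t * o := by
    refine mul_left_cancel₀ hg0 ?_
    rw [h2, h4, hstep e]
    ring
  refine h1 ((PointValue.of_aeval q).unique h.spec ?_)
  rw [hq]
  simpa using h.value_zero.mul h3

/-- Numerator and denominator are each a power of t times a unit, so comparing the two exponents
decides whether f or its inverse is regular. -/
lemma value_or_inv_value (f : L) :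
    (∃ c, PointValue w a f c) ∨ ∃ c, PointValue w a f⁻¹ c := by
  by_cases hf : f = 0
  · exact .inl ⟨0, by simpa [hf] using PointValue.const (w := w) (a := a) 0⟩
  obtain ⟨p, q, hq, hpq⟩ := h.frac f
  have hp : aeval w p ≠ 0 := by rw [← hpq]; exact mul_ne_zero hf hq
  obtain ⟨e, g, d, hd, hg, hpe⟩ := h.exists_eq_pow_mul hp (PointValue.of_aeval p)
  obtain ⟨e', g', d', hd', hg', hqe⟩ := h.exists_eq_pow_mul hq (PointValue.of_aeval q)
  rw [eq_div_of_mul_eq hq hpq, hpe, hqe]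
  rw [hpe] at hp
  rw [hqe] at hq
  rcases le_total e' e with hle | hle
  · obtain ⟨r, rfl⟩ := Nat.exists_eq_add_of_le hle
    left
    have : t ^ (e' + r) * g / (t ^ e' * g') = t ^ r * (g * g'⁻¹) := by
      rw [pow_add, mul_assoc, mul_div_mul_left _ _ (left_ne_zero_of_mul hq)]
      ring
    exact ⟨_, this ▸ (h.value_zero.pow r).mul (hg.mul (hg'.inv h.spec hd'))⟩
  · obtain ⟨r, rfl⟩ := Nat.exists_eq_add_of_le hle
    right
    have : (t ^ e * g / (t ^ (e + r) * g'))⁻¹ = t ^ r * (g' * g⁻¹) := by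
      rw [inv_div, pow_add, mul_assoc, mul_div_mul_left _ _ (left_ne_zero_of_mul hp)]
      ring
    exact ⟨_, this ▸ (h.value_zero.pow r).mul (hg'.mul (hg.inv h.spec hd))⟩

/-- The local ring of a regular point, as a valuation ring of the function field. -/
def localRing : ValuationSubring L where
  carrier := {f | ∃ c, PointValue w a f c}
  mul_mem' := fun ⟨_, h1⟩ ⟨_, h2⟩ => ⟨_, h1.mul h2⟩
  one_mem' := ⟨1, by simpa using PointValue.const (w := w) (a := a) 1⟩
  add_mem' := fun ⟨_, h1⟩ ⟨_, h2⟩ => ⟨_, h1.add h2⟩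
  zero_mem' := ⟨0, by simpa using PointValue.const (w := w) (a := a) 0⟩
  neg_mem' := fun ⟨_, h1⟩ => ⟨_, h1.neg⟩
  mem_or_inv_mem' := h.value_or_inv_value

lemma mem_localRing {f : L} : f ∈ h.localRing ↔ ∃ c, PointValue w a f c := Iff.rfl

lemma mem_nonunits_localRing {f : L} : f ∈ h.localRing.nonunits ↔ PointValue w a f 0 := by
  rw [ValuationSubring.mem_nonunits_iff_or, mem_localRing]
  constructor
  · rintro (rfl | hf)
    · simpa using PointValue.const (w := w) (a := a) 0
    · rcases h.value_or_inv_value f with ⟨c, hc⟩ | hc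
      · by_cases hc0 : c = 0
        · exact hc0 ▸ hc
        · exact absurd ⟨_, hc.inv h.spec hc0⟩ hf
      · exact absurd hc hf
  · intro hf
    refine or_iff_not_imp_left.2 ?_
    rintro hf0 ⟨c, hc⟩
    have h1 := hf.mul hc
    rw [mul_inv_cancel₀ hf0, zero_mul] at h1
    exact zero_ne_one (h1.unique h.spec (by simpa using PointValue.const (w := w) (a := a) 1))

end IsRegularPoint
end LocalRings

/-! ### Values of functions in a valuation ring over the complex numbers -/

namespace ValuationSubring

open Polynomial

variable {F : Type} [Field F] {V : ValuationSubring F}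

lemma mul_mem_nonunits {f g : F} (hf : f ∈ V) (hg : g ∈ V.nonunits) : f * g ∈ V.nonunits := by
  rw [mem_nonunits_iff] at *
  rw [map_mul]
  exact mul_lt_one_of_nonneg_of_lt_one_right ((V.valuation_le_one_iff f).2 hf) zero_le hg

lemma valuation_eq_one_of_notMem_nonunits {f : F} (hf : f ∈ V) (h : f ∉ V.nonunits) :
    V.valuation f = 1 := by
  rw [mem_nonunits_iff, not_lt] at h
  exact le_antisymm ((V.valuation_le_one_iff f).2 hf) h

variable [Algebra ℂ F]

lemma valuation_algebraMap (hV : ∀ c : ℂ, algebraMap ℂ F c ∈ V) {c : ℂ} (hc : c ≠ 0) :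
    V.valuation (algebraMap ℂ F c) = 1 := by
  refine valuation_eq_one_of_notMem_nonunits (hV c) ?_
  rw [mem_nonunits_iff_or, not_or, not_not, ← map_inv₀]
  exact ⟨by simpa using hc, hV _⟩

/-- The residue of f is a root of g, hence a complex number: g splits into linear factors, and if
every f - c were a unit, g(f) would be one too. -/
lemma exists_sub_mem_nonunits (hV : ∀ c : ℂ, algebraMap ℂ F c ∈ V) {f : F} (hf : f ∈ V)
    {g : ℂ[X]} (hg : g ≠ 0) (h : aeval f g ∈ V.nonunits) :
    ∃ c : ℂ, f - algebraMap ℂ F c ∈ V.nonunits := by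
  by_contra! hcon
  have h1 : ∀ c : ℂ, V.valuation (f - algebraMap ℂ F c) = 1 := fun c =>
    valuation_eq_one_of_notMem_nonunits (sub_mem hf (hV c)) (hcon c)
  rw [mem_nonunits_iff, (IsAlgClosed.splits g).eq_prod_roots, map_mul, aeval_C, map_mul,
    valuation_algebraMap hV (leadingCoeff_ne_zero.2 hg), one_mul, map_multiset_prod,
    map_multiset_prod, Multiset.map_map, Multiset.map_map] at h
  have h2 : (g.roots.map ((V.valuation ∘ aeval f) ∘ fun c => X - C c)).prod = 1 := by
    refine Multiset.prod_eq_one fun x hx => ?_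
    obtain ⟨c, -, rfl⟩ := Multiset.mem_map.1 hx
    simpa using h1 c
  exact absurd h2 (ne_of_lt h)

lemma eq_of_sub_mem_nonunits (hV : ∀ c : ℂ, algebraMap ℂ F c ∈ V) {f : F} {c d : ℂ}
    (hc : f - algebraMap ℂ F c ∈ V.nonunits) (hd : f - algebraMap ℂ F d ∈ V.nonunits) :
    c = d := by
  by_contra hcd
  have h := V.nonunits.sub_mem hd hc
  rw [sub_sub_sub_cancel_left, ← map_sub, mem_nonunits_iff,
    valuation_algebraMap hV (sub_ne_zero.2 hcd)] at h
  exact lt_irrefl _ h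

end ValuationSubring

/-! ### Plane curves as finite covers of the line -/

namespace AdjoinRoot

open _root_.Polynomial

variable {Q : ℂ[X][X]}

/-- The ring is integral over ℂ[X], so a nonzero r divides a nonzero polynomial in the base
variable. This serves as a norm, reducing questions about zeros of r to one variable. -/
lemma exists_mul_eq_of (hQ : Q.Monic) [IsDomain (AdjoinRoot Q)] {r : AdjoinRoot Q} (hr : r ≠ 0) :
    ∃ (s : AdjoinRoot Q) (g : ℂ[X]), g ≠ 0 ∧ r * s = of Q g := by
  have : Module.Finite ℂ[X] (AdjoinRoot Q) := hQ.finite_adjoinRoot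
  have hint : IsIntegral ℂ[X] r := Algebra.IsIntegral.isIntegral r
  obtain ⟨g, hg, s, hs⟩ := hint.isAlgebraic.exists_nonzero_dvd (mem_nonZeroDivisors_of_ne_zero hr)
  exact ⟨s, g, hg, hs.symm⟩

lemma algHom_of {B : Type} [CommRing B] [Algebra ℂ B] (φ : AdjoinRoot Q →ₐ[ℂ] B) (g : ℂ[X]) :
    φ (of Q g) = aeval (φ (of Q X)) g := by
  have h := aeval_algHom_apply (φ.comp (Algebra.ofId ℂ[X] (AdjoinRoot Q) |>.restrictScalars ℂ)) X g
  rw [aeval_X_left_apply] at h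
  exact h.symm

/-- A nonzero kernel element would make the image of the base variable algebraic over ℂ, hence
constant. -/
lemma injective_algHom (hQ : Q.Monic) [IsDomain (AdjoinRoot Q)] {F : Type} [Field F] [Algebra ℂ F]
    (φ : AdjoinRoot Q →ₐ[ℂ] F) (h : ∀ c : ℂ, φ (of Q X) ≠ algebraMap ℂ F c) :
    Function.Injective φ := by
  rw [injective_iff_map_eq_zero]
  intro r hr
  by_contra hr0
  obtain ⟨s, g, hg, hrs⟩ := exists_mul_eq_of hQ hr0
  have h1 : aeval (φ (of Q X)) g = 0 := by rw [← algHom_of, ← hrs, map_mul, hr, zero_mul]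
  -- For the trivial valuation ring the only nonunit is 0, so the statement on residues says that a
  -- root of g in F is itself constant.
  obtain ⟨c, hc⟩ := ValuationSubring.exists_sub_mem_nonunits (V := ⊤)
    (fun _ => ValuationSubring.mem_top _) (ValuationSubring.mem_top _) hg
    (by rw [h1]; exact ZeroMemClass.zero_mem _)
  rw [ValuationSubring.mem_nonunits_iff_or] at hc
  exact h c (sub_eq_zero.1 (hc.resolve_right (not_not.2 (ValuationSubring.mem_top _))))

end AdjoinRoot

/-! ### The function field of the Fermat curve -/

namespace FermatCurve

open Polynomial

/-- The polynomial `y ^ n - (1 - x ^ n)` in `ℂ[x][y]`. -/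
def poly (n : ℕ) : ℂ[X][X] := X ^ n - C (1 - X ^ n)

lemma monic_poly (n : ℕ) [NeZero n] : (poly n).Monic := monic_X_pow_sub_C _ (NeZero.ne n)

lemma irreducible_poly (n : ℕ) [NeZero n] : Irreducible (poly n) := by
  have hn : n ≠ 0 := NeZero.ne n
  have hm := monic_poly n
  have hd : (poly n).natDegree = n := natDegree_X_pow_sub_C
  have hP : (Ideal.span {(X - C 1 : ℂ[X])}).IsPrime :=
    (Ideal.span_singleton_prime (X_sub_C_ne_zero 1)).2 (prime_X_sub_C 1)
  refine irreducible_of_eisenstein_criterion hP ?_ ?_ ?_ ?_ hm.isPrimitive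
  · rw [hm.leadingCoeff]
    exact (Ideal.ne_top_iff_one _).1 hP.ne_top
  · intro m hmn
    rw [degree_eq_natDegree hm.ne_zero, hd, Nat.cast_lt] at hmn
    rw [poly, coeff_sub, coeff_X_pow, if_neg hmn.ne, coeff_C, zero_sub]
    split_ifs
    · rw [neg_mem_iff, Ideal.mem_span_singleton, dvd_iff_isRoot]
      simp
    · simp
  · rw [← natDegree_pos_iff_degree_pos, hd]
    exact Nat.pos_of_ne_zero hn
  · rw [poly, coeff_sub, coeff_X_pow, if_neg (Ne.symm hn), coeff_C_zero, zero_sub, neg_mem_iff,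
      Ideal.span_singleton_pow, Ideal.mem_span_singleton]
    rintro ⟨g, hg⟩
    -- Eisenstein at X - 1 needs 1 to be a simple root of 1 - X^n: the derivative there is -n,
    -- whereas a multiple of (X - 1)^2 has derivative 0 at 1.
    have h := congrArg (fun f => (derivative f).eval 1) hg
    simp [derivative_mul, derivative_pow] at h
    exact hn h

/-- The coordinate ring of the affine Fermat curve `x ^ n + y ^ n = 1`. -/
abbrev CoordinateRing (n : ℕ) : Type := AdjoinRoot (poly n)

instance (n : ℕ) [NeZero n] : IsDomain (CoordinateRing n) :=
  AdjoinRoot.isDomain_of_prime (irreducible_poly n).prime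

/-- The function field of the Fermat curve. -/
abbrev FunctionField (n : ℕ) : Type := FractionRing (CoordinateRing n)

variable (n : ℕ) [NeZero n]

/-- The coordinate functions `x / z`, `y / z` and `1`. -/
def coords : Fin 3 → FunctionField n :=
  ![algebraMap (CoordinateRing n) _ (AdjoinRoot.of (poly n) X),
    algebraMap (CoordinateRing n) _ (AdjoinRoot.root (poly n)), 1]

variable {n} in
/-- The homomorphism out of the coordinate ring given by two elements `s`, `t` with
`s ^ n + t ^ n = 1`. -/
def coordinateRingLift {B : Type} [CommRing B] [Algebra ℂ B] (s t : B) (h : s ^ n + t ^ n = 1) :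
    CoordinateRing n →ₐ[ℂ] B :=
  AdjoinRoot.liftAlgHom (poly n) (aeval s) t (by
    rw [poly, eval₂_sub, eval₂_X_pow, eval₂_C]
    simp [← h])


variable {n}

section Lift

variable {B : Type} [CommRing B] [Algebra ℂ B] {s t : B} (h : s ^ n + t ^ n = 1)

omit [NeZero n] in
lemma coordinateRingLift_of (g : ℂ[X]) :
    coordinateRingLift s t h (AdjoinRoot.of (poly n) g) = aeval s g := by
  simp [coordinateRingLift]

omit [NeZero n] in
lemma coordinateRingLift_root : coordinateRingLift s t h (AdjoinRoot.root (poly n)) = t := by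
  simp [coordinateRingLift]

end Lift

section Extend

variable {F : Type} [Field F] [Algebra ℂ F] {s t : F} (h : s ^ n + t ^ n = 1)
  (hs : ∀ c, s ≠ algebraMap ℂ F c)

include hs in
lemma injective_coordinateRingLift : Function.Injective (coordinateRingLift s t h) :=
  AdjoinRoot.injective_algHom (monic_poly n) _ fun c => by
    rw [coordinateRingLift_of, aeval_X]
    exact hs c

/-- The homomorphism out of the function field given by two elements `s`, `t` of a field with
`s ^ n + t ^ n = 1` and `s` not constant. -/
def functionFieldLift : FunctionField n →ₐ[ℂ] F :=
  IsFractionRing.liftAlgHom (injective_coordinateRingLift h hs)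

lemma functionFieldLift_algebraMap (r : CoordinateRing n) :
    functionFieldLift h hs (algebraMap _ _ r) = coordinateRingLift s t h r := by
  simp [functionFieldLift]

lemma functionFieldLift_coords (i : Fin 3) :
    functionFieldLift h hs (coords n i) = ![s, t, 1] i := by
  fin_cases i
  · simp [coords, functionFieldLift_algebraMap, coordinateRingLift_of]
  · simp [coords, functionFieldLift_algebraMap, coordinateRingLift_root]
  · simp [coords]

end Extend

omit [NeZero n] in
lemma coords_two : coords n 2 = 1 := rfl

omit [NeZero n] in
lemma coords_pow : coords n 0 ^ n + coords n 1 ^ n = 1 := by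
  have h : (AdjoinRoot.of (poly n) X) ^ n + (AdjoinRoot.root (poly n)) ^ n = 1 := by
    have h : eval₂ (AdjoinRoot.of (poly n)) (AdjoinRoot.root (poly n)) (X ^ n - C (1 - X ^ n)) = 0 :=
      AdjoinRoot.eval₂_root (poly n)
    rw [eval₂_sub, eval₂_X_pow, eval₂_C, map_sub, map_one, map_pow] at h
    rw [sub_eq_zero.1 h, add_sub_cancel]
  have h' := congrArg (algebraMap (CoordinateRing n) (FunctionField n)) h
  simpa [coords] using h'

omit [NeZero n] in
lemma aeval_coords (p : MvPolynomial (Fin 3) ℂ) :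
    MvPolynomial.aeval (coords n) p = algebraMap (CoordinateRing n) _ (MvPolynomial.aeval
      ![AdjoinRoot.of (poly n) X, AdjoinRoot.root (poly n), 1] p) := by
  rw [← MvPolynomial.aeval_algebraMap_apply]
  congr 2
  funext i
  fin_cases i <;> simp [coords]

omit [NeZero n] in
lemma coordinateRingLift_aeval {B : Type} [CommRing B] [Algebra ℂ B] {s t : B}
    (h : s ^ n + t ^ n = 1) (p : MvPolynomial (Fin 3) ℂ) :
    coordinateRingLift s t h (MvPolynomial.aeval
      ![AdjoinRoot.of (poly n) X, AdjoinRoot.root (poly n), 1] p) =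
      MvPolynomial.aeval ![s, t, 1] p := by
  rw [MvPolynomial.comp_aeval_apply]
  congr 2
  funext i
  fin_cases i <;> simp [coordinateRingLift_of, coordinateRingLift_root]

-- Any relation between the coordinate functions holds for every solution of s^n + t^n = 1 in any
-- ℂ-algebra. It is used both to evaluate at affine points and to transport relations along
-- substitutions.
omit [NeZero n] in
lemma aeval_eq_zero_of_aeval_coords {B : Type} [CommRing B] [Algebra ℂ B] {s t : B}
    (h : s ^ n + t ^ n = 1) {p : MvPolynomial (Fin 3) ℂ}
    (hp : MvPolynomial.aeval (coords n) p = 0) : MvPolynomial.aeval ![s, t, 1] p = 0 := by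
  rw [aeval_coords, FaithfulSMul.algebraMap_eq_zero_iff] at hp
  rw [← coordinateRingLift_aeval h, hp, map_zero]

/-- Otherwise x^m would equal c at every affine point, but every complex number d is the
x-coordinate of one. -/
lemma coords_zero_pow_ne {m : ℕ} (hm : m ≠ 0) (c : ℂ) :
    coords n 0 ^ m ≠ algebraMap ℂ (FunctionField n) c := by
  intro h
  obtain ⟨d, hd⟩ : ∃ d : ℂ, d ^ m ≠ c := by
    by_cases hc : c = 0
    · exact ⟨1, by simp [hc]⟩
    · exact ⟨0, by rw [zero_pow hm]; exact Ne.symm hc⟩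
  obtain ⟨e, he⟩ := IsAlgClosed.exists_pow_nat_eq (1 - d ^ n) (Nat.pos_of_ne_zero (NeZero.ne n))
  have hde : d ^ n + e ^ n = 1 := by rw [he]; ring
  have h1 := aeval_eq_zero_of_aeval_coords (n := n) hde
    (p := MvPolynomial.X 0 ^ m - MvPolynomial.C c) (by simp [h])
  rw [map_sub, map_pow, MvPolynomial.aeval_X, MvPolynomial.aeval_C] at h1
  exact hd (sub_eq_zero.1 h1)

lemma coords_zero_ne (c : ℂ) : coords n 0 ≠ algebraMap ℂ (FunctionField n) c := by
  simpa using coords_zero_pow_ne (n := n) one_ne_zero c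

omit [NeZero n] in
lemma exists_aeval_coords_eq (r : CoordinateRing n) : ∃ p : MvPolynomial (Fin 3) ℂ,
    MvPolynomial.aeval (coords n) p = algebraMap _ _ r := by
  induction r using AdjoinRoot.induction_on with
  | ih g =>
    refine ⟨g.sum fun i a => aeval (MvPolynomial.X 0) a * MvPolynomial.X 1 ^ i, ?_⟩
    rw [aeval_coords]
    congr 1
    conv_rhs => rw [g.as_sum_support_C_mul_X_pow]
    rw [Polynomial.sum, map_sum, map_sum]
    refine Finset.sum_congr rfl fun i _ => ?_
    simp only [map_mul, map_pow, MvPolynomial.aeval_X, AdjoinRoot.mk_X, AdjoinRoot.mk_C]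
    congr 1
    rw [← aeval_algHom_apply, MvPolynomial.aeval_X]
    exact (AdjoinRoot.algHom_of (AlgHom.id ℂ _) _).symm

lemma exists_eq_div (f : FunctionField n) : ∃ p q : MvPolynomial (Fin 3) ℂ,
    MvPolynomial.aeval (coords n) q ≠ 0 ∧
      f * MvPolynomial.aeval (coords n) q = MvPolynomial.aeval (coords n) p := by
  obtain ⟨a, b, hb, rfl⟩ := IsFractionRing.div_surjective (A := CoordinateRing n) f
  obtain ⟨p, hp⟩ := exists_aeval_coords_eq a
  obtain ⟨q, hq⟩ := exists_aeval_coords_eq b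
  have hb0 : algebraMap (CoordinateRing n) (FunctionField n) b ≠ 0 := by
    simpa using nonZeroDivisors.ne_zero hb
  exact ⟨p, q, by rwa [hq], by rw [hp, hq, div_mul_cancel₀ _ hb0]⟩

end FermatCurve

/-! ### Homogeneous polynomials -/

namespace MvPolynomial

lemma IsHomogeneous.aeval_smul {d : ℕ} {p : MvPolynomial (Fin 3) ℂ} (hp : p.IsHomogeneous d)
    {B : Type} [CommRing B] [Algebra ℂ B] (t : B) (w : Fin 3 → B) :
    MvPolynomial.aeval (fun i => t * w i) p = t ^ d * MvPolynomial.aeval w p := by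
  rw [aeval_def, aeval_def, eval₂_eq', eval₂_eq', Finset.mul_sum]
  refine Finset.sum_congr rfl fun m hm => ?_
  have h : ∑ i, m i = d := by
    rw [← hp (mem_support_iff.1 hm), Finsupp.weight_apply, Finsupp.sum_fintype _ _ (by simp)]
    simp
  simp_rw [mul_pow]
  rw [Finset.prod_mul_distrib, Finset.prod_pow_eq_pow_sum, h]
  ring

/-- The degree d component is padded with X_i^(N - d). The degree N is left free so that a numerator
and a denominator can be given the same degree. -/
lemma exists_homogenization (i : Fin 3) (p : MvPolynomial (Fin 3) ℂ) {N : ℕ}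
    (hN : p.totalDegree ≤ N) : ∃ r : MvPolynomial (Fin 3) ℂ, r.IsHomogeneous N ∧
      ∀ (B : Type) [CommRing B] [Algebra ℂ B] (w : Fin 3 → B), w i = 1 →
        aeval w r = aeval w p := by
  refine ⟨∑ d ∈ Finset.range (p.totalDegree + 1), X i ^ (N - d) * homogeneousComponent d p,
    ?_, fun B _ _ w hw => ?_⟩
  · refine IsHomogeneous.sum _ _ _ fun d hd => ?_
    have hd' : d ≤ p.totalDegree := Nat.lt_succ_iff.1 (Finset.mem_range.1 hd)
    have h := ((isHomogeneous_X ℂ i).pow (N - d)).mul (homogeneousComponent_isHomogeneous d p)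
    rwa [one_mul, Nat.sub_add_cancel (hd'.trans hN)] at h
  · conv_rhs => rw [← sum_homogeneousComponent p]
    rw [map_sum, map_sum]
    refine Finset.sum_congr rfl fun d _ => ?_
    rw [map_mul, map_pow, aeval_X, hw, one_pow, one_mul]

end MvPolynomial

/-! ### Points of the Fermat curve and its function field -/

namespace FermatCurve

open MvPolynomial (aeval eval)

variable {n : ℕ}

lemma ext_of_rep_eq_smul {P Q : FermatCurve n} {t : ℂ} (h : ∀ i, Q.pt.rep i = t * P.pt.rep i) :
    P = Q := by
  obtain ⟨P, hP⟩ := P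
  obtain ⟨Q, hQ⟩ := Q
  have : Q = P := by
    rw [← P.mk_rep, ← Q.mk_rep, Projectivization.mk_eq_mk_iff']
    exact ⟨t, (funext h).symm⟩
  simp [this]

/-- The point of the Fermat curve with given homogeneous coordinates. -/
def ofVec (w : Fin 3 → ℂ) (hw : w ≠ 0) (h : w 0 ^ n + w 1 ^ n = w 2 ^ n) : FermatCurve n where
  pt := .mk ℂ w hw
  eqn := by
    obtain ⟨t, ht⟩ := Projectivization.exists_smul_eq_mk_rep ℂ w hw
    simp only [← ht, Units.smul_def, Pi.smul_apply, smul_eq_mul, mul_pow]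
    rw [← mul_add, h]

lemma rep_ofVec (w : Fin 3 → ℂ) (hw : w ≠ 0) (h : w 0 ^ n + w 1 ^ n = w 2 ^ n) :
    ∃ t : ℂ, t ≠ 0 ∧ ∀ i, (ofVec w hw h).pt.rep i = t * w i := by
  obtain ⟨t, ht⟩ := Projectivization.exists_smul_eq_mk_rep ℂ w hw
  exact ⟨t, t.ne_zero, fun i => by change (Projectivization.mk ℂ w hw).rep i = _; rw [← ht]; rfl⟩

variable [NeZero n]

/-- If two coordinates vanished, the equation would kill the third. The last clause records that i,
j, l is a permutation of 0, 1, 2, in the form needed to reorder the terms of the Fermat equation. -/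
lemma exists_coordinates (P : FermatCurve n) : ∃ i j l : Fin 3,
    P.pt.rep i ≠ 0 ∧ P.pt.rep j ≠ 0 ∧ (∀ k, k = i ∨ k = j ∨ k = l) ∧
      ∀ (B : Type) [AddCommGroup B] (f : Fin 3 → B), f 0 + f 1 + f 2 = f i + f j + f l := by
  have hn := NeZero.ne n
  have h0 := P.pt.rep_nonzero
  have h := P.eqn
  by_cases h2 : P.pt.rep 2 = 0
  · have hx : P.pt.rep 0 ≠ 0 := by
      intro hx
      rw [h2, hx, zero_pow hn, zero_add] at h
      have hy := eq_zero_of_pow_eq_zero h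
      exact h0 (funext fun i => by fin_cases i <;> simpa)
    have hy : P.pt.rep 1 ≠ 0 := by
      intro hy
      rw [h2, hy, zero_pow hn, add_zero] at h
      exact hx (eq_zero_of_pow_eq_zero h)
    exact ⟨0, 1, 2, hx, hy, by decide, fun B _ f => rfl⟩
  · by_cases hx : P.pt.rep 0 = 0
    · refine ⟨2, 1, 0, h2, ?_, by decide, fun B _ f => by abel⟩
      intro hy
      rw [hx, hy, zero_pow hn, add_zero] at h
      exact h2 (eq_zero_of_pow_eq_zero h.symm)
    · exact ⟨2, 0, 1, h2, hx, by decide, fun B _ f => by abel⟩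

/-- For z ≠ 0 this is evaluation at an affine solution. A point at infinity is first moved into the
chart by exchanging x and z, which preserves the Fermat equation once y is multiplied by an n-th
root θ of -1. -/
lemma eval_rep_eq_zero {p : MvPolynomial (Fin 3) ℂ} {d : ℕ} (hp : p.IsHomogeneous d)
    (h : aeval (coords n) p = 0) (P : FermatCurve n) : eval P.pt.rep p = 0 := by
  have hP := P.eqn
  rw [← MvPolynomial.aeval_eq_eval]
  by_cases h2 : P.pt.rep 2 = 0
  · have hx : P.pt.rep 0 ≠ 0 := by
      intro hx
      rw [h2, hx, zero_pow (NeZero.ne n), zero_add] at hP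
      exact P.pt.rep_nonzero (funext fun i => by
        fin_cases i
        exacts [hx, eq_zero_of_pow_eq_zero hP, h2])
    obtain ⟨θ, hθ⟩ := IsAlgClosed.exists_pow_nat_eq (-1 : ℂ) (Nat.pos_of_ne_zero (NeZero.ne n))
    have hθ0 : θ ≠ 0 := by
      rintro rfl
      rw [zero_pow (NeZero.ne n)] at hθ
      norm_num at hθ
    have hX : coords n 0 ≠ 0 := by simpa using coords_zero_ne (n := n) 0
    have hst : ((coords n 0)⁻¹) ^ n +
        (algebraMap ℂ (FunctionField n) θ * ((coords n 0)⁻¹ * coords n 1)) ^ n = 1 := by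
      have h1 : algebraMap ℂ (FunctionField n) θ ^ n = -1 := by
        rw [← map_pow, hθ, map_neg, map_one]
      rw [mul_pow, mul_pow, h1, inv_pow]
      field_simp
      linear_combination -(coords_pow (n := n))
    have hinj := injective_coordinateRingLift hst (fun c hc => coords_zero_ne (n := n) c⁻¹ (by
      rw [map_inv₀, ← hc, inv_inv]))
    -- p' is p after the exchange: at (1/x, θ y/x, 1) it takes the value p(1, y/x, 1/x) = x^(-d)
    -- p(x, y, 1) = 0. Injectivity of the substitution then makes p' a relation between x and y
    -- themselves.
    let p' : MvPolynomial (Fin 3) ℂ := aeval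
      ![1, MvPolynomial.C θ⁻¹ * MvPolynomial.X 1, MvPolynomial.X 0] p
    have key : ∀ {B : Type} [CommRing B] [Algebra ℂ B] (w : Fin 3 → B),
        aeval w p' = aeval ![1, algebraMap ℂ B θ⁻¹ * w 1, w 0] p := by
      intro B _ _ w
      rw [MvPolynomial.comp_aeval_apply]
      congr 2
      funext i
      fin_cases i <;> simp
    have h1 : aeval ![AdjoinRoot.of (poly n) Polynomial.X, AdjoinRoot.root (poly n), 1] p' = 0 := by
      apply hinj
      rw [coordinateRingLift_aeval, map_zero, key]
      have : (![1, algebraMap ℂ (FunctionField n) θ⁻¹ * (![(coords n 0)⁻¹,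
          (algebraMap ℂ (FunctionField n) θ * ((coords n 0)⁻¹ * coords n 1)), 1] : Fin 3 → _) 1,
          (![(coords n 0)⁻¹, (algebraMap ℂ (FunctionField n) θ * ((coords n 0)⁻¹ * coords n 1)), 1]
          : Fin 3 → _) 0] : Fin 3 → FunctionField n) = fun i => (coords n 0)⁻¹ * coords n i := by
        funext i
        fin_cases i
        · simp [hX]
        · have h1 : algebraMap ℂ (FunctionField n) θ ≠ 0 := by simpa using hθ0
          simp [h1]
        · simp [coords_two]
      rw [this, hp.aeval_smul, h, mul_zero]
    -- The affine point (0, θ y/x) is the image of P under the exchange.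
    have h3 : aeval ![0, θ * (P.pt.rep 1 / P.pt.rep 0), 1] p' = 0 := by
      refine aeval_eq_zero_of_aeval_coords (n := n) ?_ (by rw [aeval_coords, h1, map_zero])
      rw [h2, zero_pow (NeZero.ne n)] at hP
      rw [mul_pow, hθ, div_pow, zero_pow (NeZero.ne n)]
      field_simp
      linear_combination -hP
    rw [key] at h3
    have h4 : P.pt.rep = fun i => P.pt.rep 0 * (![1, algebraMap ℂ ℂ θ⁻¹ *
        (![0, θ * (P.pt.rep 1 / P.pt.rep 0), 1] : Fin 3 → ℂ) 1,
        (![0, θ * (P.pt.rep 1 / P.pt.rep 0), 1] : Fin 3 → ℂ) 0] : Fin 3 → ℂ) i := by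
      funext i
      fin_cases i
      · simp
      · simp
        field_simp
      · simpa using h2
    rw [h4, hp.aeval_smul, h3, mul_zero]
  · have h3 := aeval_eq_zero_of_aeval_coords (n := n) (s := P.pt.rep 0 / P.pt.rep 2)
      (t := P.pt.rep 1 / P.pt.rep 2) (by
        rw [div_pow, div_pow, ← add_div, hP, div_self (pow_ne_zero n h2)]) h
    have h4 : P.pt.rep = fun i => P.pt.rep 2 *
        (![P.pt.rep 0 / P.pt.rep 2, P.pt.rep 1 / P.pt.rep 2, 1] : Fin 3 → ℂ) i := by
      funext i
      fin_cases i
      · simp; field_simp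
      · simp; field_simp
      · simp
    rw [h4, hp.aeval_smul, h3, mul_zero]

end FermatCurve

/-! ### The Zariski topology and the places of the Fermat curve -/

namespace FermatCurve

open MvPolynomial (aeval eval)

variable {n : ℕ} [NeZero n]

lemma coords_ne_zero (P : FermatCurve n) {i : Fin 3} (h : P.pt.rep i ≠ 0) : coords n i ≠ 0 := by
  intro h0
  refine h ?_
  simpa using eval_rep_eq_zero (MvPolynomial.isHomogeneous_X ℂ i) (by simpa using h0) P

omit [NeZero n] in
lemma finite_setOf_pow_eq (hn : n ≠ 0) (c : ℂ) : {ξ : ℂ | ξ ^ n = c}.Finite := by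
  classical
  refine (Polynomial.nthRoots n c).toFinset.finite_toSet.subset fun ξ hξ => ?_
  simpa [Polynomial.mem_nthRoots (Nat.pos_of_ne_zero hn)] using hξ

lemma x_ne_zero_of_z_eq_zero {P : FermatCurve n} (h : P.z = 0) : P.x ≠ 0 := by
  intro hx
  have hP : P.x ^ n + P.y ^ n = P.z ^ n := P.eqn
  rw [h, hx, zero_pow (NeZero.ne n), zero_add] at hP
  refine P.pt.rep_nonzero (funext fun i => ?_)
  fin_cases i
  exacts [hx, eq_zero_of_pow_eq_zero hP, h]

omit [NeZero n] in
lemma eq_of_div_z {P Q : FermatCurve n} (hP : P.z ≠ 0) (hQ : Q.z ≠ 0)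
    (hx : P.x / P.z = Q.x / Q.z) (hy : P.y / P.z = Q.y / Q.z) : P = Q := by
  refine ext_of_rep_eq_smul (t := Q.z / P.z) fun i => ?_
  fin_cases i
  · change Q.x = Q.z / P.z * P.x
    rw [div_mul_eq_mul_div, mul_div_assoc, hx, mul_div_cancel₀ _ hQ]
  · change Q.y = Q.z / P.z * P.y
    rw [div_mul_eq_mul_div, mul_div_assoc, hy, mul_div_cancel₀ _ hQ]
  · exact (div_mul_cancel₀ _ hP).symm

lemma eq_of_div_x {P Q : FermatCurve n} (hP : P.z = 0) (hQ : Q.z = 0)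
    (hy : P.y / P.x = Q.y / Q.x) : P = Q := by
  have hPx := x_ne_zero_of_z_eq_zero hP
  have hQx := x_ne_zero_of_z_eq_zero hQ
  refine ext_of_rep_eq_smul (t := Q.x / P.x) fun i => ?_
  fin_cases i
  · exact (div_mul_cancel₀ _ hPx).symm
  · change Q.y = Q.x / P.x * P.y
    rw [div_mul_eq_mul_div, mul_div_assoc, hy, mul_div_cancel₀ _ hQx]
  · change Q.z = Q.x / P.x * P.z
    rw [hP, hQ, mul_zero]

lemma div_x_pow {P : FermatCurve n} (h : P.z = 0) : (P.y / P.x) ^ n = -1 := by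
  have hx := x_ne_zero_of_z_eq_zero h
  have hP : P.x ^ n + P.y ^ n = P.z ^ n := P.eqn
  rw [h, zero_pow (NeZero.ne n)] at hP
  rw [div_pow, div_eq_iff (pow_ne_zero n hx)]
  linear_combination hP

omit [NeZero n] in
lemma div_z_pow {P : FermatCurve n} (h : P.z ≠ 0) : (P.x / P.z) ^ n + (P.y / P.z) ^ n = 1 := by
  have hP : P.x ^ n + P.y ^ n = P.z ^ n := P.eqn
  rw [div_pow, div_pow, ← add_div, hP, div_self (pow_ne_zero n h)]

lemma finite_setOf_z_eq_zero : {P : FermatCurve n | P.z = 0}.Finite :=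
  Set.Finite.of_finite_image ((finite_setOf_pow_eq (NeZero.ne n) (-1)).subset
    (by rintro _ ⟨P, hP, rfl⟩; exact div_x_pow hP))
    (f := fun P : FermatCurve n => P.y / P.x) fun _ hP _ hQ => eq_of_div_x hP hQ

/-- At an affine zero, x is a root of the nonzero polynomial g that p divides in the coordinate
ring, and each x allows finitely many y. The points at infinity are finite in number. -/
lemma finite_zeros {d : ℕ} {p : MvPolynomial (Fin 3) ℂ} (hp : p.IsHomogeneous d)
    (h : aeval (coords n) p ≠ 0) : {P : FermatCurve n | eval P.pt.rep p = 0}.Finite := by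
  set r : CoordinateRing n :=
    aeval ![AdjoinRoot.of (poly n) Polynomial.X, AdjoinRoot.root (poly n), 1] p with hr
  have hr0 : r ≠ 0 := fun h0 => h (by rw [aeval_coords, ← hr, h0, map_zero])
  obtain ⟨s, g, hg, hrs⟩ := AdjoinRoot.exists_mul_eq_of (monic_poly n) hr0
  have hfin : {P : FermatCurve n | eval P.pt.rep p = 0 ∧ P.z ≠ 0}.Finite := by
    have hS : (⋃ c ∈ g.roots.toFinset, (fun ξ : ℂ => (c, ξ)) '' {ξ | ξ ^ n = 1 - c ^ n}).Finite :=
      g.roots.toFinset.finite_toSet.biUnion fun c _ =>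
        (finite_setOf_pow_eq (NeZero.ne n) _).image _
    refine Set.Finite.of_finite_image (hS.subset ?_)
      (f := fun P : FermatCurve n => (P.x / P.z, P.y / P.z)) fun P hP Q hQ hPQ =>
        eq_of_div_z hP.2 hQ.2 (Prod.ext_iff.1 hPQ).1 (Prod.ext_iff.1 hPQ).2
    rintro _ ⟨P, ⟨hP, hz⟩, rfl⟩
    have hxy := div_z_pow hz
    simp only [Set.mem_iUnion]
    refine ⟨P.x / P.z, ?_, P.y / P.z, by rw [Set.mem_ofPred_eq, ← hxy]; ring, rfl⟩
    rw [Multiset.mem_toFinset, Polynomial.mem_roots hg, Polynomial.IsRoot.def,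
      ← Polynomial.coe_aeval_eq_eval, ← coordinateRingLift_of hxy, ← hrs, map_mul, hr,
      coordinateRingLift_aeval]
    have h4 : P.pt.rep = fun i => P.z * (![P.x / P.z, P.y / P.z, 1] : Fin 3 → ℂ) i := by
      funext i
      fin_cases i
      · exact (mul_div_cancel₀ _ hz).symm
      · exact (mul_div_cancel₀ _ hz).symm
      · exact (mul_one _).symm
    rw [← MvPolynomial.aeval_eq_eval, h4] at hP
    replace hP := (hp.aeval_smul P.z ![P.x / P.z, P.y / P.z, 1]).symm.trans hP
    rw [(mul_eq_zero.1 hP).resolve_left (pow_ne_zero _ hz), zero_mul]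
  refine (hfin.union finite_setOf_z_eq_zero).subset fun P hP => ?_
  by_cases hz : P.z = 0
  · exact .inr hz
  · exact .inl ⟨hP, hz⟩

lemma finite_compl_of_isOpen {U : Set (FermatCurve n)} (hU : IsOpen U) (hne : U.Nonempty) :
    Uᶜ.Finite := by
  induction hU with
  | basic s hs =>
    obtain ⟨d, p, hp, rfl⟩ := hs
    obtain ⟨P, hP⟩ := hne
    refine (finite_zeros hp fun h => hP (eval_rep_eq_zero hp h P)).subset fun Q hQ => ?_
    simpa using hQ
  | univ => simp
  | inter s t _ _ hs ht =>
    rw [Set.compl_inter]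
    exact (hs (hne.mono Set.inter_subset_left)).union (ht (hne.mono Set.inter_subset_right))
  | sUnion S _ ih =>
    obtain ⟨P, s, hs, hP⟩ := hne
    exact (ih s hs ⟨P, hP⟩).subset (Set.compl_subset_compl.2 (Set.subset_sUnion_of_mem hs))

omit [NeZero n] in
lemma isOpen_setOf_eval_ne_zero {d : ℕ} {p : MvPolynomial (Fin 3) ℂ} (hp : p.IsHomogeneous d) :
    IsOpen {P : FermatCurve n | eval P.pt.rep p ≠ 0} :=
  TopologicalSpace.isOpen_generateFrom_of_mem ⟨d, p, hp, rfl⟩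

omit [NeZero n] in
lemma isClosed_singleton (P : FermatCurve n) : IsClosed {P} := by
  rw [← isOpen_compl_iff]
  -- The 2 × 2 minors of the matrix with rows P and (X_0, X_1, X_2); their common zero locus is P.
  let ℓ : Fin 3 → Fin 3 → MvPolynomial (Fin 3) ℂ := fun i j =>
    MvPolynomial.C (P.pt.rep j) * MvPolynomial.X i - MvPolynomial.C (P.pt.rep i) * MvPolynomial.X j
  have hℓ : ∀ i j, (ℓ i j).IsHomogeneous (0 + 1) := fun i j =>
    ((MvPolynomial.isHomogeneous_C _ _).mul (MvPolynomial.isHomogeneous_X _ _)).sub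
      ((MvPolynomial.isHomogeneous_C _ _).mul (MvPolynomial.isHomogeneous_X _ _))
  have : ({P}ᶜ : Set (FermatCurve n)) =
      ⋃ i, ⋃ j, {Q : FermatCurve n | eval Q.pt.rep (ℓ i j) ≠ 0} := by
    ext Q
    simp only [Set.mem_compl_iff, Set.mem_singleton_iff, Set.mem_iUnion, Set.mem_ofPred_eq]
    rw [← not_iff_not]
    push Not
    constructor
    · rintro rfl i j
      simp [ℓ]
      ring
    · intro h
      obtain ⟨i, hi⟩ := Function.ne_iff.1 P.pt.rep_nonzero
      refine (ext_of_rep_eq_smul (t := Q.pt.rep i / P.pt.rep i) fun j => ?_).symm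
      have h1 := h j i
      simp only [ℓ, map_sub, map_mul, MvPolynomial.eval_C, MvPolynomial.eval_X] at h1
      have hi' : P.pt.rep i ≠ 0 := hi
      field_simp
      linear_combination h1
  rw [this]
  exact isOpen_iUnion fun i => isOpen_iUnion fun j => isOpen_setOf_eval_ne_zero (hℓ i j)

lemma isOpen_iff {U : Set (FermatCurve n)} : IsOpen U ↔ (U.Nonempty → Uᶜ.Finite) := by
  refine ⟨finite_compl_of_isOpen, fun h => ?_⟩
  rcases U.eq_empty_or_nonempty with rfl | hne
  · exact isOpen_empty
  · rw [← isClosed_compl_iff, ← Set.biUnion_of_singleton Uᶜ]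
    exact (h hne).isClosed_biUnion fun P _ => P.isClosed_singleton

/-- Smoothness. In the chart where coordinate i is 1, the partial derivative of the equation in
direction j is, up to sign, n a_j^(n-1) ≠ 0, so the remaining coordinate, minus its value, is a
uniformizer. -/
lemma isRegularPoint (P : FermatCurve n) {i j l : Fin 3} (hi : P.pt.rep i ≠ 0)
    (hj : P.pt.rep j ≠ 0) (hk : ∀ k, k = i ∨ k = j ∨ k = l)
    (hs : ∀ (B : Type) [AddCommGroup B] (f : Fin 3 → B), f 0 + f 1 + f 2 = f i + f j + f l) :
    IsRegularPoint (fun k => (coords n i)⁻¹ * coords n k)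
      (fun k => (P.pt.rep i)⁻¹ * P.pt.rep k)
      ((coords n i)⁻¹ * coords n l - algebraMap ℂ _ ((P.pt.rep i)⁻¹ * P.pt.rep l)) := by
  have hc := P.coords_ne_zero hi
  have hspec : IsSpecialization (fun k => (coords n i)⁻¹ * coords n k)
      (fun k => (P.pt.rep i)⁻¹ * P.pt.rep k) := by
    intro p hp
    obtain ⟨r, hr, hr'⟩ := MvPolynomial.exists_homogenization i p le_rfl
    rw [← hr' _ _ (inv_mul_cancel₀ hc), hr.aeval_smul] at hp
    have h1 := eval_rep_eq_zero hr
      ((mul_eq_zero.1 hp).resolve_left (pow_ne_zero _ (inv_ne_zero hc))) P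
    rw [← MvPolynomial.aeval_eq_eval] at h1 ⊢
    rw [← hr' _ _ (inv_mul_cancel₀ hi), hr.aeval_smul, h1, mul_zero]
  refine ⟨hspec, fun f => ?_, ?_, fun k => ?_⟩
  · obtain ⟨p, q, hq, hpq⟩ := exists_eq_div f
    obtain ⟨p', hp', hp''⟩ := MvPolynomial.exists_homogenization 2 p
      (le_max_left p.totalDegree q.totalDegree)
    obtain ⟨q', hq', hq''⟩ := MvPolynomial.exists_homogenization 2 q
      (le_max_right p.totalDegree q.totalDegree)
    refine ⟨p', q', ?_, ?_⟩
    · rw [hq'.aeval_smul, hq'' _ _ coords_two]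
      exact mul_ne_zero (pow_ne_zero _ (inv_ne_zero hc)) hq
    · rw [hq'.aeval_smul, hq'' _ _ coords_two, hp'.aeval_smul, hp'' _ _ coords_two, ← hpq]
      ring
  · simpa using (PointValue.coord (w := fun k => (coords n i)⁻¹ * coords n k)
      (a := fun k => (P.pt.rep i)⁻¹ * P.pt.rep k) l).sub
      (PointValue.const ((P.pt.rep i)⁻¹ * P.pt.rep l))
  · set w : Fin 3 → FunctionField n := fun k => (coords n i)⁻¹ * coords n k with hw
    set a : Fin 3 → ℂ := fun k => (P.pt.rep i)⁻¹ * P.pt.rep k with ha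
    change ∃ g c, PointValue w a g c ∧
      w k - algebraMap ℂ _ (a k) = (w l - algebraMap ℂ _ (a l)) * g
    have hwi : w i = 1 := inv_mul_cancel₀ hc
    have hai : a i = 1 := inv_mul_cancel₀ hi
    have haj : a j ≠ 0 := mul_ne_zero (inv_ne_zero hi) hj
    rcases hk k with rfl | rfl | rfl
    · exact ⟨_, _, PointValue.const 0, by rw [hwi, hai]; simp⟩
    · let e : Fin 3 → ℂ := ![1, 1, -1]
      have he : e k ≠ 0 := by fin_cases k <;> simp [e]
      have h1 : algebraMap ℂ _ (e i) * w i ^ n + algebraMap ℂ _ (e k) * w k ^ n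
          + algebraMap ℂ _ (e l) * w l ^ n = 0 := by
        rw [← hs _ (fun k => algebraMap ℂ _ (e k) * w k ^ n)]
        simp only [hw, mul_pow, e, coords_two]
        simp
        linear_combination (coords n i ^ n)⁻¹ * coords_pow (n := n)
      have h2 : e i * a i ^ n + e k * a k ^ n + e l * a l ^ n = 0 := by
        rw [← hs _ (fun k => e k * a k ^ n)]
        simp only [ha, mul_pow, e]
        simp
        linear_combination (P.pt.rep i ^ n)⁻¹ * P.eqn
      set g : Fin 3 → FunctionField n := fun k =>
        ∑ m ∈ Finset.range n, w k ^ m * algebraMap ℂ _ (a k) ^ (n - 1 - m) with hg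
      have hgv : ∀ k, PointValue w a (g k)
          (∑ m ∈ Finset.range n, a k ^ m * a k ^ (n - 1 - m)) := fun k =>
        PointValue.sum _ fun m _ => ((PointValue.coord k).pow m).mul ((PointValue.const _).pow _)
      have hgm : ∀ k, g k * (w k - algebraMap ℂ _ (a k)) = w k ^ n - algebraMap ℂ _ (a k ^ n) :=
        fun k => by rw [map_pow]; exact (Commute.all _ _).geom_sum₂_mul n
      have hgk : (∑ m ∈ Finset.range n, a k ^ m * a k ^ (n - 1 - m)) ≠ 0 := by
        have : ∀ m ∈ Finset.range n, a k ^ m * a k ^ (n - 1 - m) = a k ^ (n - 1) := by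
          intro m hm
          rw [← pow_add]
          congr 1
          have := Finset.mem_range.1 hm
          omega
        rw [Finset.sum_congr rfl this, Finset.sum_const, Finset.card_range, nsmul_eq_mul]
        exact mul_ne_zero (Nat.cast_ne_zero.2 (NeZero.ne n)) (pow_ne_zero _ haj)
      have hgk0 : g k ≠ 0 := fun h0 => hgk ((hgv k).unique hspec (by
        rw [h0]; simpa using PointValue.const (w := w) (a := a) 0))
      refine ⟨_, _, ((PointValue.const (-(e l) / e k)).mul (hgv l)).mul
        ((hgv k).inv hspec hgk), ?_⟩
      have he' : algebraMap ℂ (FunctionField n) (e k) ≠ 0 := by simpa using he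
      have h3 : algebraMap ℂ (FunctionField n) (e k) * (g k * (w k - algebraMap ℂ _ (a k))) =
          - algebraMap ℂ (FunctionField n) (e l) * (g l * (w l - algebraMap ℂ _ (a l))) := by
        have h2' := congrArg (algebraMap ℂ (FunctionField n)) h2
        rw [hwi] at h1
        rw [hai] at h2'
        simp only [map_add, map_mul, map_pow, map_zero, map_one] at h2'
        rw [hgm, hgm, map_pow, map_pow]
        linear_combination h1 - h2'
      rw [map_div₀, map_neg]
      field_simp
      linear_combination h3
    · exact ⟨_, _, PointValue.const 1, by simp⟩

/-- The rational function `f` on the Fermat curve is regular at `P`, with value `c`. -/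
def HasValueAt (P : FermatCurve n) (f : FunctionField n) (c : ℂ) : Prop :=
  ∃ (d : ℕ) (p q : MvPolynomial (Fin 3) ℂ), p.IsHomogeneous d ∧ q.IsHomogeneous d ∧
    eval P.pt.rep q ≠ 0 ∧ f * aeval (coords n) q = aeval (coords n) p ∧
      c * eval P.pt.rep q = eval P.pt.rep p

lemma hasValueAt_iff (P : FermatCurve n) {i : Fin 3} (hi : P.pt.rep i ≠ 0) {f : FunctionField n}
    {c : ℂ} : P.HasValueAt f c ↔ PointValue (fun k => (coords n i)⁻¹ * coords n k)
      (fun k => (P.pt.rep i)⁻¹ * P.pt.rep k) f c := by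
  have hc := P.coords_ne_zero hi
  unfold HasValueAt PointValue
  simp only [← MvPolynomial.aeval_eq_eval]
  constructor
  · rintro ⟨d, p, q, hp, hq, h1, h2, h3⟩
    refine ⟨p, q, ?_, ?_, ?_⟩
    · rw [hq.aeval_smul]
      exact mul_ne_zero (pow_ne_zero _ (inv_ne_zero hi)) h1
    · rw [hp.aeval_smul, hq.aeval_smul, ← h2]
      ring
    · rw [hp.aeval_smul, hq.aeval_smul, ← h3]
      ring
  · rintro ⟨p, q, h1, h2, h3⟩
    obtain ⟨p', hp', hp''⟩ := MvPolynomial.exists_homogenization i p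
      (le_max_left p.totalDegree q.totalDegree)
    obtain ⟨q', hq', hq''⟩ := MvPolynomial.exists_homogenization i q
      (le_max_right p.totalDegree q.totalDegree)
    rw [← hq'' _ _ (inv_mul_cancel₀ hi), hq'.aeval_smul] at h1 h3
    rw [← hq'' _ _ (inv_mul_cancel₀ hc), hq'.aeval_smul, ← hp'' _ _ (inv_mul_cancel₀ hc),
      hp'.aeval_smul] at h2
    rw [← hp'' _ _ (inv_mul_cancel₀ hi), hp'.aeval_smul] at h3
    refine ⟨max p.totalDegree q.totalDegree, p', q', hp', hq', right_ne_zero_of_mul h1, ?_, ?_⟩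
    · refine mul_left_cancel₀ (pow_ne_zero (max p.totalDegree q.totalDegree) (inv_ne_zero hc)) ?_
      rw [← h2]
      ring
    · refine mul_left_cancel₀ (pow_ne_zero (max p.totalDegree q.totalDegree) (inv_ne_zero hi)) ?_
      rw [← h3]
      ring

/-! ### Local rings of the Fermat curve as valuation rings -/

lemma exists_place (P : FermatCurve n) : ∃ V : ValuationSubring (FunctionField n),
    (∀ f, f ∈ V ↔ ∃ c, P.HasValueAt f c) ∧ ∀ f, f ∈ V.nonunits ↔ P.HasValueAt f 0 := by
  obtain ⟨i, j, l, hi, hj, hk, hs⟩ := P.exists_coordinates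
  refine ⟨(P.isRegularPoint hi hj hk hs).localRing, fun f => ?_, fun f => ?_⟩
  · simp only [P.hasValueAt_iff hi]
    exact IsRegularPoint.mem_localRing _
  · rw [P.hasValueAt_iff hi]
    exact IsRegularPoint.mem_nonunits_localRing _

/-- The local ring of the Fermat curve at `P`, as a valuation ring of the function field. -/
def place (P : FermatCurve n) : ValuationSubring (FunctionField n) := P.exists_place.choose

lemma mem_place {P : FermatCurve n} {f : FunctionField n} :
    f ∈ P.place ↔ ∃ c, P.HasValueAt f c := P.exists_place.choose_spec.1 f

lemma mem_nonunits_place {P : FermatCurve n} {f : FunctionField n} :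
    f ∈ P.place.nonunits ↔ P.HasValueAt f 0 := P.exists_place.choose_spec.2 f

namespace HasValueAt

variable {P : FermatCurve n} {f g : FunctionField n} {c d : ℂ}

lemma const (c : ℂ) : P.HasValueAt (algebraMap ℂ _ c) c := by
  obtain ⟨i, -, -, hi, -⟩ := P.exists_coordinates
  exact (P.hasValueAt_iff hi).2 (PointValue.const c)

lemma add (hf : P.HasValueAt f c) (hg : P.HasValueAt g d) : P.HasValueAt (f + g) (c + d) := by
  obtain ⟨i, -, -, hi, -⟩ := P.exists_coordinates
  rw [P.hasValueAt_iff hi] at *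
  exact hf.add hg

lemma mul (hf : P.HasValueAt f c) (hg : P.HasValueAt g d) : P.HasValueAt (f * g) (c * d) := by
  obtain ⟨i, -, -, hi, -⟩ := P.exists_coordinates
  rw [P.hasValueAt_iff hi] at *
  exact hf.mul hg

lemma pow (hf : P.HasValueAt f c) (e : ℕ) : P.HasValueAt (f ^ e) (c ^ e) := by
  obtain ⟨i, -, -, hi, -⟩ := P.exists_coordinates
  rw [P.hasValueAt_iff hi] at *
  exact hf.pow e

lemma sub (hf : P.HasValueAt f c) (hg : P.HasValueAt g d) : P.HasValueAt (f - g) (c - d) := by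
  obtain ⟨i, -, -, hi, -⟩ := P.exists_coordinates
  rw [P.hasValueAt_iff hi] at *
  exact hf.sub hg

lemma unique (hf : P.HasValueAt f c) (hg : P.HasValueAt f d) : c = d := by
  obtain ⟨i, j, l, hi, hj, hk, hs⟩ := P.exists_coordinates
  rw [P.hasValueAt_iff hi] at *
  exact hf.unique (P.isRegularPoint hi hj hk hs).spec hg

end HasValueAt

lemma hasValueAt_iff_sub_mem_nonunits {P : FermatCurve n} {f : FunctionField n} {c : ℂ} :
    P.HasValueAt f c ↔ f - algebraMap ℂ _ c ∈ P.place.nonunits := by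
  rw [mem_nonunits_place]
  constructor
  · intro h
    simpa using h.sub (.const c)
  · intro h
    simpa using h.add (.const c)

omit [NeZero n] in
lemma hasValueAt_x {P : FermatCurve n} (h : P.z ≠ 0) :
    P.HasValueAt (coords n 0) (P.x / P.z) :=
  ⟨1, .X 0, .X 2, MvPolynomial.isHomogeneous_X _ _, MvPolynomial.isHomogeneous_X _ _,
    by rwa [MvPolynomial.eval_X], by simp [coords_two], by
      rw [MvPolynomial.eval_X, MvPolynomial.eval_X]
      exact div_mul_cancel₀ P.x h⟩

omit [NeZero n] in
lemma hasValueAt_y {P : FermatCurve n} (h : P.z ≠ 0) :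
    P.HasValueAt (coords n 1) (P.y / P.z) :=
  ⟨1, .X 1, .X 2, MvPolynomial.isHomogeneous_X _ _, MvPolynomial.isHomogeneous_X _ _,
    by rwa [MvPolynomial.eval_X], by simp [coords_two], by
      rw [MvPolynomial.eval_X, MvPolynomial.eval_X]
      exact div_mul_cancel₀ P.y h⟩

lemma hasValueAt_inv_x {P : FermatCurve n} (h : P.z = 0) :
    P.HasValueAt (coords n 0)⁻¹ 0 := by
  have hx := x_ne_zero_of_z_eq_zero h
  exact ⟨1, .X 2, .X 0, MvPolynomial.isHomogeneous_X _ _, MvPolynomial.isHomogeneous_X _ _,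
    by rwa [MvPolynomial.eval_X], by simpa [coords_two] using inv_mul_cancel₀ (P.coords_ne_zero (i := 0) hx),
    by
      rw [zero_mul, MvPolynomial.eval_X]
      exact h.symm⟩

end FermatCurve

/-! ### Every place of the function field is a point of the Fermat curve -/

namespace FermatCurve

open MvPolynomial (aeval eval)

variable {n : ℕ} [NeZero n]

section Dominated

variable {F : Type} [Field F] [Algebra ℂ F] {V : ValuationSubring F}
  (hV : ∀ c : ℂ, algebraMap ℂ F c ∈ V)
include hV

lemma aeval_sub_eval_mem_nonunits {w : Fin 3 → F} {a : Fin 3 → ℂ}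
    (h : ∀ k, w k - algebraMap ℂ F (a k) ∈ V.nonunits) (p : MvPolynomial (Fin 3) ℂ) :
    aeval w p - algebraMap ℂ F (eval a p) ∈ V.nonunits := by
  induction p using MvPolynomial.induction_on with
  | C c => simp
  | add p q hp hq =>
    have := V.nonunits.add_mem hp hq
    rw [map_add, map_add, map_add]
    convert this using 1
    ring
  | mul_X p i hp =>
    have hw : w i ∈ V := by
      simpa using add_mem (V.nonunits_subset (h i)) (hV (a i))
    have := V.nonunits.add_mem (V.mul_mem_nonunits hw hp)
      (V.mul_mem_nonunits (hV (eval a p)) (h i))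
    rw [map_mul, map_mul, map_mul, MvPolynomial.aeval_X, MvPolynomial.eval_X]
    convert this using 1
    ring

lemma sub_mem_nonunits_of_pointValue {w : Fin 3 → F} {a : Fin 3 → ℂ}
    (h : ∀ k, w k - algebraMap ℂ F (a k) ∈ V.nonunits) {f : F} {c : ℂ}
    (hf : PointValue w a f c) : f - algebraMap ℂ F c ∈ V.nonunits := by
  obtain ⟨p, q, h1, h2, h3⟩ := hf
  have hq := aeval_sub_eval_mem_nonunits hV h q
  have hq' : aeval w q ∉ V.nonunits := fun h0 =>
    h1 (ValuationSubring.eq_of_sub_mem_nonunits hV hq (by simpa using h0))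
  rw [ValuationSubring.mem_nonunits_iff_or, not_or, not_not] at hq'
  have hp := aeval_sub_eval_mem_nonunits hV h (p - MvPolynomial.C c * q)
  have he : eval a (p - MvPolynomial.C c * q) = 0 := by simp [h3]
  rw [he, map_zero, sub_zero, map_sub, map_mul,
    MvPolynomial.aeval_C, ← h2, ← sub_mul] at hp
  have := V.mul_mem_nonunits hq'.2 hp
  rwa [mul_comm, mul_inv_cancel_right₀ hq'.1] at this

end Dominated

variable {V : ValuationSubring (FunctionField n)}

/-- A valuation ring is maximal for domination: V contains the local ring, and its maximal ideal
contains that of the local ring, which forces the reverse inclusion. -/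
lemma place_eq_of_dominated (hV : ∀ c : ℂ, algebraMap ℂ (FunctionField n) c ∈ V)
    {P : FermatCurve n} {i : Fin 3} (hi : P.pt.rep i ≠ 0)
    (h : ∀ k, (coords n i)⁻¹ * coords n k - algebraMap ℂ _ ((P.pt.rep i)⁻¹ * P.pt.rep k) ∈
      V.nonunits) : P.place = V := by
  refine le_antisymm (fun f hf => ?_) (ValuationSubring.nonunits_le_nonunits.1 fun f hf => ?_)
  · obtain ⟨c, hc⟩ := mem_place.1 hf
    simpa using add_mem (V.nonunits_subset
      (sub_mem_nonunits_of_pointValue hV h ((P.hasValueAt_iff hi).1 hc))) (hV c)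
  · simpa using sub_mem_nonunits_of_pointValue hV h
      ((P.hasValueAt_iff hi).1 (mem_nonunits_place.1 hf))

omit [NeZero n] in
lemma exists_root_of_pow_sub_mem_nonunits (hn : n ≠ 0)
    {F : Type} [Field F] [Algebra ℂ F] {V : ValuationSubring F}
    (hV : ∀ c : ℂ, algebraMap ℂ F c ∈ V) {f : F} {c : ℂ}
    (h : f ^ n - algebraMap ℂ F c ∈ V.nonunits) :
    ∃ b : ℂ, b ^ n = c ∧ f - algebraMap ℂ F b ∈ V.nonunits := by
  have hfn : f ^ n ∈ V := by simpa using add_mem (V.nonunits_subset h) (hV c)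
  have hf : f ∈ V := by
    rw [← V.valuation_le_one_iff] at hfn ⊢
    rw [map_pow] at hfn
    exact (pow_le_one_iff hn).1 hfn
  obtain ⟨b, hb⟩ := ValuationSubring.exists_sub_mem_nonunits hV hf
    (g := Polynomial.X ^ n - Polynomial.C c) (Polynomial.X_pow_sub_C_ne_zero
      (Nat.pos_of_ne_zero hn) c) (by simpa using h)
  refine ⟨b, ValuationSubring.eq_of_sub_mem_nonunits hV ?_ h, hb⟩
  rw [map_pow, ← (Commute.all f (algebraMap ℂ F b)).geom_sum₂_mul n]
  exact V.mul_mem_nonunits (sum_mem fun i _ => mul_mem (pow_mem hf _) (pow_mem (hV b) _)) hb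

/-- The residues of the coordinates at V are complex numbers satisfying the Fermat equation. They
define a point whose local ring V dominates. -/
lemma exists_place_eq (hV : ∀ c : ℂ, algebraMap ℂ (FunctionField n) c ∈ V) (hne : V ≠ ⊤) :
    ∃ P : FermatCurve n, P.place = V := by
  have hn := NeZero.ne n
  have hX0 : coords n 0 ≠ 0 := by simpa using coords_zero_ne (n := n) 0
  by_cases hX : coords n 0 ∈ V
  · have hY : coords n 1 ∈ V := by
      have hYn : coords n 1 ^ n ∈ V := by
        rw [eq_sub_of_add_eq' (coords_pow (n := n))]
        exact sub_mem (one_mem V) (pow_mem hX n)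
      rw [← V.valuation_le_one_iff] at hYn ⊢
      rw [map_pow] at hYn
      exact (pow_le_one_iff hn).1 hYn
    have hmem : ∀ p : MvPolynomial (Fin 3) ℂ, aeval (coords n) p ∈ V := by
      intro p
      induction p using MvPolynomial.induction_on with
      | C c => simpa using hV c
      | add p q hp hq => simpa using add_mem hp hq
      | mul_X p i hp =>
        rw [map_mul, MvPolynomial.aeval_X]
        refine mul_mem hp ?_
        fin_cases i
        exacts [hX, hY, one_mem V]
    -- If every nonzero polynomial in x and y were a unit of V, then V would be the whole field. A
    -- multiple g(x) of such a q makes x algebraic modulo the maximal ideal.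
    obtain ⟨q, hq0, hq⟩ : ∃ q : MvPolynomial (Fin 3) ℂ,
        aeval (coords n) q ≠ 0 ∧ aeval (coords n) q ∈ V.nonunits := by
      by_contra! hcon
      refine hne (eq_top_iff.2 fun f _ => ?_)
      obtain ⟨p, q, hq, hpq⟩ := exists_eq_div f
      have h1 := hcon q hq
      rw [ValuationSubring.mem_nonunits_iff_or, not_or, not_not] at h1
      rw [← mul_inv_cancel_right₀ hq f, hpq]
      exact mul_mem (hmem p) h1.2
    obtain ⟨a, ha⟩ : ∃ a : ℂ, coords n 0 - algebraMap ℂ _ a ∈ V.nonunits := by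
      have hr0 : aeval ![AdjoinRoot.of (poly n) Polynomial.X, AdjoinRoot.root (poly n), 1] q ≠ 0 :=
        fun h0 => hq0 (by rw [aeval_coords, h0, map_zero])
      obtain ⟨s, g, hg, hrs⟩ := AdjoinRoot.exists_mul_eq_of (monic_poly n) hr0
      refine ValuationSubring.exists_sub_mem_nonunits hV hX hg ?_
      obtain ⟨s', hs'⟩ := exists_aeval_coords_eq s
      have h1 := congrArg (algebraMap (CoordinateRing n) (FunctionField n)) hrs
      rw [map_mul, ← aeval_coords, ← hs', mul_comm] at h1
      have h2 : algebraMap (CoordinateRing n) (FunctionField n) (AdjoinRoot.of (poly n) g) =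
          Polynomial.aeval (coords n 0) g :=
        AdjoinRoot.algHom_of (IsScalarTower.toAlgHom ℂ (CoordinateRing n) (FunctionField n)) g
      rw [← h2, ← h1]
      exact V.mul_mem_nonunits (hmem s') hq
    obtain ⟨b, hb, hb'⟩ := exists_root_of_pow_sub_mem_nonunits (n := n) hn hV
      (f := coords n 1) (c := 1 - a ^ n) (by
        have h1 := V.mul_mem_nonunits (neg_mem (sum_mem (t := Finset.range n) fun i _ =>
          mul_mem (pow_mem hX i) (pow_mem (hV a) (n - 1 - i)))) ha
        rw [neg_mul, (Commute.all _ _).geom_sum₂_mul n] at h1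
        convert h1 using 1
        rw [map_sub, map_one, map_pow]
        linear_combination coords_pow (n := n))
    obtain ⟨t, ht, hrep⟩ := rep_ofVec (n := n) ![a, b, 1] (fun h => by simpa using congrFun h 2)
      (by simp [hb])
    refine ⟨_, place_eq_of_dominated hV (i := 2)
      (P := ofVec (n := n) ![a, b, 1] (fun h => by simpa using congrFun h 2) (by simp [hb])) ?_ ?_⟩
    · rw [hrep]
      simpa using ht
    · intro k
      rw [hrep, hrep, coords_two, mul_inv, mul_mul_mul_comm, inv_mul_cancel₀ ht]
      fin_cases k
      · simpa using ha
      · simpa using hb'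
      · simp [coords_two]
  -- The centre lies at infinity: 1/x has residue 0, so the residue b of y/x satisfies b^n = -1 and
  -- the point is [1 : b : 0].
  · have hX' : (coords n 0)⁻¹ ∈ V.nonunits :=
      (V.inv_mem_nonunits_iff).2 (.inr hX)
    obtain ⟨b, hb, hb'⟩ := exists_root_of_pow_sub_mem_nonunits (n := n) hn hV
      (f := (coords n 0)⁻¹ * coords n 1) (c := -1) (by
        have h1 := V.mul_mem_nonunits (pow_mem (V.nonunits_subset hX') (n - 1)) hX'
        rw [← pow_succ, Nat.sub_add_cancel (Nat.pos_of_ne_zero hn)] at h1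
        convert h1 using 1
        rw [map_neg, map_one, mul_pow, inv_pow]
        field_simp
        linear_combination coords_pow (n := n))
    have hw : (![1, b, 0] : Fin 3 → ℂ) ≠ 0 := fun h => by simpa using congrFun h 0
    have he : (![1, b, 0] : Fin 3 → ℂ) 0 ^ n + (![1, b, 0] : Fin 3 → ℂ) 1 ^ n =
      (![1, b, 0] : Fin 3 → ℂ) 2 ^ n := by simp [hb, hn]
    obtain ⟨t, ht, hrep⟩ := rep_ofVec _ hw he
    refine ⟨_, place_eq_of_dominated hV (i := 0) (P := ofVec _ hw he) ?_ ?_⟩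
    · rw [hrep]
      simpa using ht
    · intro k
      rw [hrep, hrep, mul_inv, mul_mul_mul_comm, inv_mul_cancel₀ ht]
      fin_cases k
      · simp [hX0]
      · simpa using hb'
      · simpa [coords_two] using hX'

end FermatCurve

/-! ### The map from the Fermat curve to the cyclic Belyi curve -/

namespace FermatCurve

open MvPolynomial (aeval eval)

variable {n k : ℕ} [NeZero n]

lemma monic_poly_belyi (n k : ℕ) [NeZero n] : (CyclicBelyi.poly n k).Monic :=
  Polynomial.monic_X_pow_sub_C _ (NeZero.ne n)

/-- The inclusion `u ↦ x ^ n`, `v ↦ x y ^ k` of the coordinate ring of the Belyi curve. -/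
def belyiCoordinateRingMap (n k : ℕ) [NeZero n] :
    CyclicBelyi.CoordinateRing n k →ₐ[ℂ] FunctionField n :=
  AdjoinRoot.liftAlgHom (CyclicBelyi.poly n k) (Polynomial.aeval (coords n 0 ^ n))
    (coords n 0 * coords n 1 ^ k) (by
      rw [CyclicBelyi.poly, Polynomial.eval₂_sub, Polynomial.eval₂_X_pow, Polynomial.eval₂_C]
      have h : 1 - coords n 0 ^ n = coords n 1 ^ n := by
        rw [← coords_pow (n := n), add_sub_cancel_left]
      simp only [RingHom.coe_coe, map_mul, map_pow, map_sub, map_one, Polynomial.aeval_X, h]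
      ring)

lemma injective_belyiCoordinateRingMap : Function.Injective (belyiCoordinateRingMap n k) :=
  AdjoinRoot.injective_algHom (monic_poly_belyi n k) _ fun c => by
    simpa [belyiCoordinateRingMap] using coords_zero_pow_ne (n := n) (NeZero.ne n) c

/-- The inclusion `u ↦ x ^ n`, `v ↦ x y ^ k` of function fields. -/
def belyiMap (n k : ℕ) [NeZero n] : CyclicBelyi.FunctionField n k →ₐ[ℂ] FunctionField n :=
  IsFractionRing.liftAlgHom (injective_belyiCoordinateRingMap (n := n) (k := k))

lemma belyiMap_u : belyiMap n k (CyclicBelyi.u n k) = coords n 0 ^ n := by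
  simp [belyiMap, CyclicBelyi.u, belyiCoordinateRingMap]

lemma belyiMap_v : belyiMap n k (CyclicBelyi.v n k) = coords n 0 * coords n 1 ^ k := by
  simp [belyiMap, CyclicBelyi.v, belyiCoordinateRingMap]

/-- Homomorphisms out of the function field of the Belyi curve are determined by `u` and `v`. -/
lemma algHom_ext_belyi {F : Type} [Field F] [Algebra ℂ F]
    {φ ψ : CyclicBelyi.FunctionField n k →ₐ[ℂ] F}
    (hu : φ (CyclicBelyi.u n k) = ψ (CyclicBelyi.u n k))
    (hv : φ (CyclicBelyi.v n k) = ψ (CyclicBelyi.v n k)) : φ = ψ := by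
  have h : ∀ r : CyclicBelyi.CoordinateRing n k, φ (algebraMap _ _ r) = ψ (algebraMap _ _ r) := by
    intro r
    induction r using AdjoinRoot.induction_on with
    | ih g =>
      induction g using Polynomial.induction_on' with
      | add p q hp hq => rw [map_add, map_add, map_add, map_add, hp, hq]
      | monomial i a =>
        have key : ∀ χ : CyclicBelyi.FunctionField n k →ₐ[ℂ] F,
            χ (algebraMap _ _ (AdjoinRoot.mk (CyclicBelyi.poly n k) (Polynomial.monomial i a))) =
              Polynomial.aeval (χ (CyclicBelyi.u n k)) a * χ (CyclicBelyi.v n k) ^ i := by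
          intro χ
          rw [← Polynomial.C_mul_X_pow_eq_monomial, map_mul, map_pow, AdjoinRoot.mk_X,
            AdjoinRoot.mk_C, map_mul, map_pow, map_mul, map_pow]
          congr 1
          exact AdjoinRoot.algHom_of (χ.comp (IsScalarTower.toAlgHom ℂ
            (CyclicBelyi.CoordinateRing n k) (CyclicBelyi.FunctionField n k))) a
        rw [key, key, hu, hv]
  refine AlgHom.ext fun f => ?_
  obtain ⟨a, b, -, rfl⟩ := IsFractionRing.div_surjective (A := CyclicBelyi.CoordinateRing n k) f
  rw [map_div₀, map_div₀, h, h]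

/-- A nonzero function from the Belyi curve that vanishes at P. It shows that the restricted place
is nontrivial and that the fibres are finite. -/
lemma exists_belyiMap_hasValueAt_zero (k : ℕ) (P : FermatCurve n) :
    ∃ φ : CyclicBelyi.FunctionField n k, φ ≠ 0 ∧ P.HasValueAt (belyiMap n k φ) 0 := by
  have hu : ∀ c : ℂ, CyclicBelyi.u n k ≠ algebraMap ℂ _ c := by
    intro c hc
    refine coords_zero_pow_ne (n := n) (NeZero.ne n) c ?_
    rw [← belyiMap_u (k := k), hc, AlgHom.commutes]
  by_cases hz : P.z = 0
  · refine ⟨(CyclicBelyi.u n k)⁻¹, inv_ne_zero (by simpa using hu 0), ?_⟩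
    rw [map_inv₀, belyiMap_u, ← inv_pow]
    simpa [NeZero.ne n] using (hasValueAt_inv_x hz).pow n
  · refine ⟨CyclicBelyi.u n k - algebraMap ℂ _ ((P.x / P.z) ^ n), sub_ne_zero.2 (hu _), ?_⟩
    rw [map_sub, belyiMap_u, AlgHom.commutes]
    have h := ((hasValueAt_x hz).pow n).sub (.const ((P.x / P.z) ^ n))
    rwa [sub_self] at h

/-- The map to the cyclic Belyi curve: the local ring at the image of `P` consists of the
functions whose pullback is regular at `P`. -/
def toBelyi (k : ℕ) (P : FermatCurve n) : CyclicBelyiCurve n k where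
  localRing := P.place.comap (RingHomClass.toRingHom (belyiMap n k))
  const_mem c := by
    rw [ValuationSubring.mem_comap, RingHom.coe_coe, AlgHom.commutes]
    exact mem_place.2 ⟨c, .const c⟩
  ne_top h := by
    obtain ⟨φ, hφ0, hφ⟩ := exists_belyiMap_hasValueAt_zero k P
    have h1 : φ⁻¹ ∈ P.place.comap (RingHomClass.toRingHom (belyiMap n k)) := by
      rw [h]
      exact ValuationSubring.mem_top _
    obtain ⟨c, hc⟩ := mem_place.1 (ValuationSubring.mem_comap.1 h1)
    have h2 := hφ.mul hc
    rw [RingHom.coe_coe, ← map_mul, mul_inv_cancel₀ hφ0, zero_mul, map_one] at h2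
    exact zero_ne_one (h2.unique (by simpa using HasValueAt.const (P := P) 1))

lemma mem_localRing_toBelyi {P : FermatCurve n} {φ : CyclicBelyi.FunctionField n k} :
    φ ∈ (toBelyi k P).localRing ↔ ∃ c, P.HasValueAt (belyiMap n k φ) c := by
  rw [← mem_place]
  exact ValuationSubring.mem_comap

lemma hasValueAt_toBelyi {P : FermatCurve n} {φ : CyclicBelyi.FunctionField n k} {c : ℂ} :
    (toBelyi k P).HasValueAt φ c ↔ P.HasValueAt (belyiMap n k φ) c := by
  have key : ∀ ψ : CyclicBelyi.FunctionField n k,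
      ψ ∈ (toBelyi k P).localRing.nonunits ↔ belyiMap n k ψ ∈ P.place.nonunits := by
    intro ψ
    rw [ValuationSubring.mem_nonunits_iff_or, ValuationSubring.mem_nonunits_iff_or,
      mem_localRing_toBelyi, ← mem_place, map_inv₀, map_eq_zero]
  rw [CyclicBelyiCurve.HasValueAt, key, map_sub, AlgHom.commutes,
    ← hasValueAt_iff_sub_mem_nonunits]

lemma belyi_ext {R S : CyclicBelyiCurve n k} (h : R.localRing = S.localRing) : R = S := by
  cases R
  cases S
  cases h
  rfl

/-- By Chevalley's extension theorem some valuation ring A of the larger field dominates the local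
ring at R. It is the place of a point, and domination makes its restriction equal to that local
ring. -/
lemma surjective_toBelyi (n k : ℕ) [NeZero n] :
    Function.Surjective (toBelyi (n := n) k) := by
  intro R
  obtain ⟨A, hA, hloc⟩ := IsLocalRing.exists_factor_valuationRing
    ((RingHomClass.toRingHom (belyiMap n k)).comp R.localRing.subtype)
  have hmem : ∀ φ, φ ∈ R.localRing ↔ belyiMap n k φ ∈ A := by
    refine fun φ => ⟨fun h => hA ⟨φ, h⟩, fun h => ?_⟩
    by_contra hφ
    have hφ' := (R.localRing.mem_or_inv_mem φ).resolve_left hφ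
    have hφ0 : φ ≠ 0 := fun h0 => hφ (h0 ▸ R.localRing.zero_mem)
    have h1 : IsUnit (((RingHomClass.toRingHom (belyiMap n k)).comp R.localRing.subtype).codRestrict
        A.toSubring hA ⟨φ⁻¹, hφ'⟩) := by
      refine IsUnit.of_mul_eq_one ⟨belyiMap n k φ, h⟩ (Subtype.ext ?_)
      change belyiMap n k φ⁻¹ * belyiMap n k φ = 1
      rw [← map_mul, inv_mul_cancel₀ hφ0, map_one]
    obtain ⟨b, hb⟩ := ((isUnit_map_iff _ _).1 h1).exists_right_inv
    have h2 : φ⁻¹ * b.1 = 1 := congrArg Subtype.val hb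
    have h3 : b.1 = φ := by
      rw [← mul_inv_cancel_left₀ hφ0 b.1, h2, mul_one]
    exact hφ (h3 ▸ b.2)
  obtain ⟨P, rfl⟩ := exists_place_eq (V := A)
    (fun c => by
      rw [← AlgHom.commutes (belyiMap n k)]
      exact (hmem _).1 (R.const_mem c))
    (by
      rintro rfl
      exact R.ne_top (eq_top_iff.2 fun φ _ => (hmem φ).2 (ValuationSubring.mem_top _)))
  refine ⟨P, belyi_ext (SetLike.ext fun φ => ?_)⟩
  rw [hmem]
  exact ValuationSubring.mem_comap

/-! ### The fibres -/

lemma hasValueAt_u {P : FermatCurve n} (h : P.z ≠ 0) :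
    (toBelyi k P).HasValueAt (CyclicBelyi.u n k) ((P.x / P.z) ^ n) := by
  rw [hasValueAt_toBelyi, belyiMap_u]
  exact (hasValueAt_x h).pow n

lemma hasValueAt_v {P : FermatCurve n} (h : P.z ≠ 0) :
    (toBelyi k P).HasValueAt (CyclicBelyi.v n k) (P.x / P.z * (P.y / P.z) ^ k) := by
  rw [hasValueAt_toBelyi, belyiMap_v]
  exact (hasValueAt_x h).mul ((hasValueAt_y h).pow k)

lemma belyi_hasValueAt_unique {R : CyclicBelyiCurve n k} {φ : CyclicBelyi.FunctionField n k}
    {c d : ℂ} (hc : R.HasValueAt φ c) (hd : R.HasValueAt φ d) : c = d :=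
  ValuationSubring.eq_of_sub_mem_nonunits R.const_mem hc hd

lemma u_notMem {P : FermatCurve n} (h : P.z = 0) :
    CyclicBelyi.u n k ∉ (toBelyi k P).localRing := by
  rw [mem_localRing_toBelyi, belyiMap_u]
  rintro ⟨c, hc⟩
  have h1 := hc.mul ((hasValueAt_inv_x h).pow n)
  rw [inv_pow, mul_inv_cancel₀ (pow_ne_zero n (P.coords_ne_zero (x_ne_zero_of_z_eq_zero h))),
    zero_pow (NeZero.ne n), mul_zero] at h1
  exact one_ne_zero (HasValueAt.unique (by simpa using HasValueAt.const (P := P) 1) h1)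

lemma onAffineChart_toBelyi {P : FermatCurve n} : (toBelyi k P).OnAffineChart ↔ P.z ≠ 0 :=
  ⟨fun h hz => u_notMem hz h.1, fun h => ⟨(hasValueAt_u h).mem, (hasValueAt_v h).mem⟩⟩

-- Raising to a power j prime to n permutes the n-th roots of unity; the exponent m inverse to j
-- undoes it.
omit [NeZero n] in
lemma exists_pow_eq_of_coprime {j : ℕ} (hj : Nat.Coprime n j) (hn : 1 < n) {τ : ℂ}
    (hτ : τ ^ n = 1) : ∃ ω : ℂ, ω ^ n = 1 ∧ ω ^ j = τ := by
  obtain ⟨m, -, hm⟩ := Nat.exists_mul_mod_eq_one_of_coprime hj.symm hn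
  refine ⟨τ ^ m, by rw [← pow_mul, mul_comm, pow_mul, hτ, one_pow], ?_⟩
  rw [← pow_mul, mul_comm, ← Nat.div_add_mod (j * m) n, hm, pow_add, pow_mul, hτ, one_pow, one_mul,
    pow_one]

/-- The points `P` and `Q` differ by an automorphism `[x : y : z] ↦ [x : ω ^ (k + 1) y : ω ^ k z]`
for an `n`-th root of unity `ω`. -/
def Related (k : ℕ) (P Q : FermatCurve n) : Prop :=
  ∃ ω : ℂˣ, ω ^ n = 1 ∧ ∃ t : ℂ, t ≠ 0 ∧
    Q.x = t * P.x ∧ Q.y = t * ((ω : ℂ) ^ (k + 1) * P.y) ∧ Q.z = t * ((ω : ℂ) ^ k * P.z)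

lemma related_of_affine {P Q : FermatCurve n} (hP : P.z ≠ 0) (hQ : Q.z ≠ 0) {ω : ℂ}
    (hω : ω ^ n = 1) (hx : P.x / P.z = ω ^ k * (Q.x / Q.z)) (hy : Q.y / Q.z = ω * (P.y / P.z)) :
    Related k P Q := by
  have hω0 : ω ≠ 0 := by
    rintro rfl
    simp [NeZero.ne n] at hω
  refine ⟨Units.mk0 ω hω0, Units.ext (by simpa using hω), Q.z / (ω ^ k * P.z),
    div_ne_zero hQ (mul_ne_zero (pow_ne_zero k hω0) hP), ?_, ?_, ?_⟩
  · field_simp at hx ⊢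
    linear_combination -hx
  · field_simp at hy ⊢
    rw [Units.val_mk0]
    linear_combination ω ^ k * hy
  · rw [Units.val_mk0]
    field_simp

lemma related_of_x_eq_zero {P Q : FermatCurve n} (hP : P.z ≠ 0) (hQ : Q.z ≠ 0)
    (hPx : P.x = 0) (hQx : Q.x = 0) : Related k P Q := by
  have h1 := div_z_pow hP
  have h2 := div_z_pow hQ
  rw [hPx, zero_div, zero_pow (NeZero.ne n), zero_add] at h1
  rw [hQx, zero_div, zero_pow (NeZero.ne n), zero_add] at h2
  have h0 : P.y / P.z ≠ 0 := by
    intro h0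
    simp [h0, NeZero.ne n] at h1
  exact related_of_affine hP hQ (ω := (Q.y / Q.z) / (P.y / P.z)) (by rw [div_pow, h1, h2, div_one])
    (by rw [hPx, hQx]; simp) (div_mul_cancel₀ _ h0).symm

/-- Here only the x-coordinates constrain ω, through ω^k, so a k-th root of their ratio is needed.
-/
lemma related_of_y_eq_zero (hn : 1 < n) (hcop : Nat.Coprime n k) {P Q : FermatCurve n}
    (hP : P.z ≠ 0) (hQ : Q.z ≠ 0) (hPy : P.y = 0) (hQy : Q.y = 0) : Related k P Q := by
  have h1 := div_z_pow hP
  have h2 := div_z_pow hQ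
  rw [hPy, zero_div, zero_pow (NeZero.ne n), add_zero] at h1
  rw [hQy, zero_div, zero_pow (NeZero.ne n), add_zero] at h2
  have h0 : Q.x / Q.z ≠ 0 := by
    intro h0
    simp [h0, NeZero.ne n] at h2
  obtain ⟨ω, hω, hω'⟩ := exists_pow_eq_of_coprime hcop hn
    (τ := (P.x / P.z) / (Q.x / Q.z)) (by rw [div_pow, h1, h2, div_one])
  exact related_of_affine hP hQ hω (by rw [hω', div_mul_cancel₀ _ h0]) (by rw [hPy, hQy]; simp)

/-- At infinity the only coordinate is y/x, which is multiplied by ω^(k+1). -/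
lemma related_of_z_eq_zero (hn : 1 < n) (hcop : Nat.Coprime n (k + 1)) {P Q : FermatCurve n}
    (hP : P.z = 0) (hQ : Q.z = 0) : Related k P Q := by
  have h1 := div_x_pow hP
  have h2 := div_x_pow hQ
  have hx := x_ne_zero_of_z_eq_zero hP
  have hx' := x_ne_zero_of_z_eq_zero hQ
  have hη : P.y / P.x ≠ 0 := by
    intro h0
    rw [h0, zero_pow (NeZero.ne n)] at h1
    norm_num at h1
  obtain ⟨ω, hω, hω'⟩ := exists_pow_eq_of_coprime hcop hn
    (τ := (Q.y / Q.x) / (P.y / P.x)) (by rw [div_pow, h1, h2, div_self (by norm_num)])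
  have hω0 : ω ≠ 0 := by
    rintro rfl
    simp [NeZero.ne n] at hω
  refine ⟨Units.mk0 ω hω0, Units.ext (by simpa using hω), Q.x / P.x, div_ne_zero hx' hx,
    (div_mul_cancel₀ _ hx).symm, ?_, by rw [hP, hQ]; ring⟩
  rw [Units.val_mk0, hω']
  have hy : P.y ≠ 0 := fun h0 => hη (by rw [h0, zero_div])
  field_simp

lemma related_of_toBelyi_eq (hn : 1 < n) (hcop : Nat.Coprime n (k * (k + 1)))
    {P Q : FermatCurve n} (h : toBelyi k P = toBelyi k Q) : Related k P Q := by
  have hz : P.z ≠ 0 ↔ Q.z ≠ 0 := by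
    rw [← onAffineChart_toBelyi (k := k), h, onAffineChart_toBelyi]
  by_cases hP : P.z = 0
  · exact related_of_z_eq_zero hn (Nat.Coprime.coprime_mul_left_right hcop) hP
      (not_not.1 fun hQ => hz.2 hQ hP)
  · have hQ := hz.1 hP
    have hu : (P.x / P.z) ^ n = (Q.x / Q.z) ^ n :=
      belyi_hasValueAt_unique (hasValueAt_u (k := k) hP) (h ▸ hasValueAt_u hQ)
    have hv : P.x / P.z * (P.y / P.z) ^ k = Q.x / Q.z * (Q.y / Q.z) ^ k :=
      belyi_hasValueAt_unique (hasValueAt_v (k := k) hP) (h ▸ hasValueAt_v hQ)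
    have hy : (P.y / P.z) ^ n = (Q.y / Q.z) ^ n := by
      linear_combination div_z_pow hP - div_z_pow hQ - hu
    by_cases hy0 : P.y / P.z = 0
    · rw [hy0, zero_pow (NeZero.ne n)] at hy
      exact related_of_y_eq_zero hn (Nat.Coprime.coprime_mul_right_right hcop) hP hQ
        ((div_eq_zero_iff.1 hy0).resolve_right hP)
        ((div_eq_zero_iff.1 (eq_zero_of_pow_eq_zero hy.symm)).resolve_right hQ)
    · refine related_of_affine hP hQ (ω := (Q.y / Q.z) / (P.y / P.z))
        (by rw [div_pow, hy, div_self (hy ▸ pow_ne_zero n hy0)]) ?_ (div_mul_cancel₀ _ hy0).symm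
      refine mul_right_cancel₀ (pow_ne_zero k hy0) ?_
      rw [hv, div_pow _ (P.y / P.z), mul_right_comm, div_mul_cancel₀ _ (pow_ne_zero k hy0), mul_comm]

end FermatCurve

/-! ### The group action -/

namespace FermatCurve

open MvPolynomial (aeval eval)

variable {n k : ℕ} [NeZero n]

omit [NeZero n] in
lemma scale_mul (a b : Fin 3 → ℂˣ) (ha : ∀ i, a i ^ n = 1) (hb : ∀ i, b i ^ n = 1)
    (hab : ∀ i, (a * b) i ^ n = 1) (P : FermatCurve n) :
    scale (a * b) hab P = scale a ha (scale b hb P) := by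
  obtain ⟨t, ht⟩ := exists_rep_map_diag (a * b) P.pt
  obtain ⟨t', ht'⟩ := exists_rep_map_diag b P.pt
  obtain ⟨t'', ht''⟩ := exists_rep_map_diag a (scale b hb P).pt
  refine ext_of_rep_eq_smul (t := t'' * t' * (t : ℂ)⁻¹) fun i => ?_
  have h1 := congrFun ht i
  have h2 := congrFun ht' i
  have h3 := congrFun ht'' i
  change (scale (a * b) hab P).pt.rep i = _ at h1
  change (scale b hb P).pt.rep i = _ at h2
  change (scale a ha (scale b hb P)).pt.rep i = _ at h3
  rw [h3, h2, h1]
  have := t.ne_zero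
  simp only [Pi.mul_apply, Units.val_mul]
  field_simp

/-- The group of triples of `n`-th roots of unity. -/
abbrev rootTriples (n : ℕ) : Subgroup (Fin 3 → ℂˣ) := (powMonoidHom n).ker

omit [NeZero n] in
lemma rootTriples_pow (a : rootTriples n) (i : Fin 3) : a.1 i ^ n = 1 :=
  congrFun (MonoidHom.mem_ker.1 a.2) i

/-- The action of the diagonal matrices whose entries are roots of unity. -/
def scaleHom (n : ℕ) : rootTriples n →* SpaceWithFunctions.Aut (FermatCurve n) :=
  MonoidHom.mk' (fun a => scaleAut a.1 (rootTriples_pow a)) fun a b =>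
    Subtype.ext (Equiv.ext fun P => scale_mul a.1 b.1 (rootTriples_pow a) (rootTriples_pow b)
      (rootTriples_pow (a * b)) P)

omit [NeZero n] in
lemma scaleHom_apply (a : rootTriples n) (P : FermatCurve n) : ∃ t : ℂ, t ≠ 0 ∧ ∀ i,
    ((scaleHom n a : Equiv.Perm (FermatCurve n)) P).pt.rep i = t * (a.1 i * P.pt.rep i) := by
  obtain ⟨t, ht⟩ := exists_rep_map_diag a.1 P.pt
  exact ⟨t, t.ne_zero, fun i => congrFun ht i⟩

/-- The z-th power of the generator multiplies x by ζ^z and y by ω = ζ^(-mz). Since km ≡ 1 modulo n,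
ω^(-k) = ζ^z, so it is the map attached to ω up to rescaling the homogeneous coordinates. -/
lemma exists_mem_H_iff (hcop : Nat.Coprime n k) {P Q : FermatCurve n} :
    (∃ σ ∈ H n k, (σ : Equiv.Perm (FermatCurve n)) P = Q) ↔ Related k P Q := by
  set m := (k : ZMod n)⁻¹.val with hm
  have hζ : zeta n ^ n = 1 := zeta_pow n
  have hkm : zeta n ^ (k * m) = zeta n := by
    have h1 : ((k * m : ℕ) : ZMod n) = ((1 : ℕ) : ZMod n) := by
      rw [Nat.cast_mul, hm, ZMod.natCast_val, ZMod.cast_id', id_eq,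
        ZMod.coe_mul_inv_eq_one k hcop.symm, Nat.cast_one]
    rw [ZMod.natCast_eq_natCast_iff] at h1
    calc zeta n ^ (k * m) = zeta n ^ 1 := pow_eq_pow_of_modEq h1 hζ
      _ = _ := pow_one _
  let a : rootTriples n :=
    ⟨![zeta n, 1, 1], funext fun i => by fin_cases i <;> simp [hζ]⟩
  let b : rootTriples n :=
    ⟨![1, zeta n, 1], funext fun i => by fin_cases i <;> simp [hζ]⟩
  have hg : ε₀ n * ε₁ n ^ (-(m : ℤ)) = scaleHom n (a * b ^ (-(m : ℤ))) := by
    rw [map_mul, map_zpow]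
    rfl
  have hz : ∀ z : ℤ, ((a * b ^ (-(m : ℤ))) ^ z).1 =
      ![zeta n ^ z, zeta n ^ (-(m : ℤ) * z), 1] := by
    intro z
    rw [SubgroupClass.coe_zpow, Subgroup.coe_mul, SubgroupClass.coe_zpow]
    funext i
    rw [Pi.pow_apply, Pi.mul_apply, Pi.pow_apply]
    fin_cases i
    · simp [a, b]
    · simp [a, b, zpow_mul]
    · simp [a, b]
  have hrep : ∀ (z : ℤ), ∃ t : ℂ, t ≠ 0 ∧ ∀ i,
      ((scaleHom n ((a * b ^ (-(m : ℤ))) ^ z) : Equiv.Perm (FermatCurve n)) P).pt.rep i =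
        t * (((![zeta n ^ z, zeta n ^ (-(m : ℤ) * z), 1] : Fin 3 → ℂˣ) i : ℂ) * P.pt.rep i) := by
    intro z
    rw [← hz z]
    exact scaleHom_apply _ P
  have hωk : ∀ z : ℤ, (zeta n ^ (-(m : ℤ) * z)) ^ k = (zeta n ^ z)⁻¹ := by
    intro z
    have h2 : -(m : ℤ) * z * k = ((k * m : ℕ) : ℤ) * (-z) := by push_cast; ring
    rw [← zpow_natCast, ← zpow_mul, h2, zpow_mul, zpow_natCast, hkm, zpow_neg]
  constructor
  · rintro ⟨σ, hσ, rfl⟩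
    obtain ⟨z, rfl⟩ := Subgroup.mem_zpowers_iff.1 hσ
    rw [hg, ← map_zpow]
    obtain ⟨t, ht, h⟩ := hrep z
    generalize (scaleHom n ((a * b ^ (-(m : ℤ))) ^ z) : Equiv.Perm (FermatCurve n)) P = Q at h ⊢
    have h0 := h 0
    have h1 := h 1
    have h2 := h 2
    simp only [Matrix.cons_val_zero, Matrix.cons_val_one, Matrix.cons_val, Units.val_one, one_mul]
      at h0 h1 h2
    have hk : ((zeta n ^ (-(m : ℤ) * z) : ℂˣ) : ℂ) ^ k = ((zeta n : ℂ) ^ z)⁻¹ := by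
      rw [← Units.val_pow_eq_pow_val, hωk]
      simp
    have hne : (zeta n : ℂ) ^ z ≠ 0 := zpow_ne_zero _ (zeta n).ne_zero
    refine ⟨zeta n ^ (-(m : ℤ) * z), ?_, t * (zeta n : ℂ) ^ z, mul_ne_zero ht hne, ?_, ?_, ?_⟩
    · rw [← zpow_natCast, zpow_comm, zpow_natCast, hζ, one_zpow]
    · rw [x, h0, x, Units.val_zpow_eq_zpow_val, mul_assoc]
    · rw [y, h1, y, pow_succ, hk]
      simp
      field_simp
    · rw [FermatCurve.z, h2, FermatCurve.z, hk]
      field_simp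
  · rintro ⟨ω, hω, t, ht, h0, h1, h2⟩
    obtain ⟨j, -, hj⟩ := (Complex.isPrimitiveRoot_exp n (NeZero.ne n)).eq_pow_of_pow_eq_one
      (ξ := (ω : ℂ)) (by rw [← Units.val_pow_eq_pow_val, hω, Units.val_one])
    have hj' : zeta n ^ j = ω := Units.ext (by simpa [zeta] using hj)
    have hz1 : zeta n ^ (-(k * j : ℕ) : ℤ) = (ω ^ k)⁻¹ := by
      rw [zpow_neg, zpow_natCast, mul_comm, pow_mul, hj']
    have hz2 : zeta n ^ (-(m : ℤ) * (-(k * j : ℕ) : ℤ)) = ω := by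
      have h3 : -(m : ℤ) * (-(k * j : ℕ) : ℤ) = ((k * m * j : ℕ) : ℤ) := by push_cast; ring
      rw [h3, zpow_natCast, pow_mul, hkm, hj']
    -- For ω = ζ^j the exponent must satisfy ζ^z = ω^(-k), hence z = -kj.
    refine ⟨_, Subgroup.zpow_mem_zpowers _ (-(k * j : ℕ) : ℤ), ?_⟩
    rw [hg, ← map_zpow]
    obtain ⟨s, hs, h⟩ := hrep (-(k * j : ℕ) : ℤ)
    rw [hz1, hz2] at h
    have hne : (ω : ℂ) ^ k ≠ 0 := pow_ne_zero _ ω.ne_zero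
    refine ext_of_rep_eq_smul (t := t / s * ω ^ k) fun i => ?_
    rw [h]
    fin_cases i
    · refine h0.trans ?_
      rw [x]
      simp
      field_simp
    · refine h1.trans ?_
      rw [y]
      simp
      field_simp
      ring
    · refine h2.trans ?_
      rw [FermatCurve.z]
      simp
      field_simp

/-! ### The action on the function field -/

/-- The automorphism `x ↦ ω ^ (-k) x`, `y ↦ ω y` of the function field. -/
def twist (k : ℕ) (ω : ℂˣ) (hω : ω ^ n = 1) : FunctionField n →ₐ[ℂ] FunctionField n :=
  functionFieldLift (s := algebraMap ℂ _ ((ω : ℂ) ^ k)⁻¹ * coords n 0)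
    (t := algebraMap ℂ _ (ω : ℂ) * coords n 1)
    (by
      have h : (ω : ℂ) ^ n = 1 := by rw [← Units.val_pow_eq_pow_val, hω, Units.val_one]
      rw [mul_pow, mul_pow, ← map_pow, ← map_pow, inv_pow, ← pow_mul, mul_comm k, pow_mul, h,
        one_pow, inv_one, map_one, one_mul, one_mul, coords_pow])
    (fun c hc => coords_zero_ne (n := n) ((ω : ℂ) ^ k * c) (by
      have hne : (ω : ℂ) ^ k ≠ 0 := pow_ne_zero _ ω.ne_zero
      rw [map_mul, ← hc, ← mul_assoc, ← map_mul, mul_inv_cancel₀ hne, map_one, one_mul]))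

variable {ω : ℂˣ} (hω : ω ^ n = 1)

lemma twist_x : twist k ω hω (coords n 0) = algebraMap ℂ _ ((ω : ℂ) ^ k)⁻¹ * coords n 0 :=
  functionFieldLift_coords _ _ 0

lemma twist_y : twist k ω hω (coords n 1) = algebraMap ℂ _ (ω : ℂ) * coords n 1 :=
  functionFieldLift_coords _ _ 1

lemma twist_belyiMap (φ : CyclicBelyi.FunctionField n k) :
    twist k ω hω (belyiMap n k φ) = belyiMap n k φ := by
  have h : (ω : ℂ) ^ n = 1 := by rw [← Units.val_pow_eq_pow_val, hω, Units.val_one]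
  have hne : (ω : ℂ) ^ k ≠ 0 := pow_ne_zero _ ω.ne_zero
  have key : (twist k ω hω).comp (belyiMap n k) = belyiMap n k := by
    refine algHom_ext_belyi ?_ ?_
    · rw [AlgHom.comp_apply, belyiMap_u, map_pow, twist_x, mul_pow, ← map_pow, inv_pow, ← pow_mul,
        mul_comm k, pow_mul, h, one_pow, inv_one, map_one, one_mul]
    · rw [AlgHom.comp_apply, belyiMap_v, map_mul, map_pow, twist_x, twist_y, mul_pow,
        mul_mul_mul_comm, ← map_pow, ← map_mul, inv_mul_cancel₀ hne, map_one, one_mul]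
  exact DFunLike.congr_fun key φ

/-- `twist` is pullback along P ↦ Q. On forms of degree d the two substitutions differ by the factor
ω^(kd), which cancels between numerator and denominator. -/
lemma hasValueAt_twist {P Q : FermatCurve n} {t : ℂ} (ht : t ≠ 0) (hx : Q.x = t * P.x)
    (hy : Q.y = t * ((ω : ℂ) ^ (k + 1) * P.y)) (hz : Q.z = t * ((ω : ℂ) ^ k * P.z))
    {f : FunctionField n} {c : ℂ} (h : Q.HasValueAt f c) : P.HasValueAt (twist k ω hω f) c := by
  obtain ⟨d, p, q, hp, hq, h1, h2, h3⟩ := h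
  let b : Fin 3 → ℂˣ := ![1, ω ^ (k + 1), ω ^ k]
  have hne : (ω : ℂ) ^ k ≠ 0 := pow_ne_zero _ ω.ne_zero
  have hrep : Q.pt.rep = fun i => t * (b i * P.pt.rep i) := by
    funext i
    fin_cases i
    · exact hx.trans (by simp [b, x])
    · exact hy.trans (by simp [b, y])
    · exact hz.trans (by simp [b, z])
  have key : ∀ {B : Type} [CommRing B] [Algebra ℂ B] (w : Fin 3 → B) (r : MvPolynomial (Fin 3) ℂ),
      aeval w (aeval (fun i => MvPolynomial.C (b i : ℂ) * MvPolynomial.X i) r) =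
        aeval (fun i => algebraMap ℂ B (b i : ℂ) * w i) r := by
    intro B _ _ w r
    rw [MvPolynomial.comp_aeval_apply]
    congr 2
    funext i
    simp
  have hev : ∀ r : MvPolynomial (Fin 3) ℂ, r.IsHomogeneous d → eval Q.pt.rep r =
      t ^ d * eval P.pt.rep
        (aeval (fun i => MvPolynomial.C (b i : ℂ) * MvPolynomial.X i) r) := by
    intro r hr
    rw [← MvPolynomial.aeval_eq_eval, ← MvPolynomial.aeval_eq_eval, key, hrep]
    exact hr.aeval_smul _ _
  have haev : ∀ r : MvPolynomial (Fin 3) ℂ, r.IsHomogeneous d → aeval (coords n)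
      (aeval (fun i => MvPolynomial.C (b i : ℂ) * MvPolynomial.X i) r) =
        algebraMap ℂ _ ((ω : ℂ) ^ k) ^ d * twist k ω hω (aeval (coords n) r) := by
    intro r hr
    rw [key, MvPolynomial.comp_aeval_apply, ← hr.aeval_smul]
    congr 2
    funext i
    fin_cases i
    · change _ = _ * twist k ω hω (coords n 0)
      rw [twist_x, ← mul_assoc, ← map_mul, mul_inv_cancel₀ hne]
      simp [b]
    · change _ = _ * twist k ω hω (coords n 1)
      rw [twist_y, ← mul_assoc, ← map_mul, ← pow_succ]
      simp [b]
    · change _ = _ * twist k ω hω (coords n 2)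
      rw [coords_two, map_one]
      simp [b, coords_two]
  have ht' := pow_ne_zero d ht
  refine ⟨d, _, _, isHomogeneous_bind (a := b) hp, isHomogeneous_bind (a := b) hq, ?_, ?_, ?_⟩
  · rw [hev q hq] at h1
    exact right_ne_zero_of_mul h1
  · rw [haev p hp, haev q hq, ← h2, map_mul]
    ring
  · refine mul_left_cancel₀ ht' ?_
    rw [← hev p hp, ← h3, hev q hq]
    ring

omit [NeZero n] in
lemma Related.symm {P Q : FermatCurve n} (h : Related k P Q) : Related k Q P := by
  obtain ⟨ω, hω, t, ht, hx, hy, hz⟩ := h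
  have hne := ω.ne_zero
  refine ⟨ω⁻¹, by rw [inv_pow, hω, inv_one], t⁻¹, inv_ne_zero ht, ?_, ?_, ?_⟩
  · rw [hx]; field_simp
  · rw [hy]; simp; field_simp
  · rw [hz]; simp; field_simp

lemma Related.mem_localRing {P Q : FermatCurve n} (h : Related k P Q)
    {φ : CyclicBelyi.FunctionField n k} (hφ : φ ∈ (toBelyi k Q).localRing) :
    φ ∈ (toBelyi k P).localRing := by
  obtain ⟨ω, hω, t, ht, hx, hy, hz⟩ := h
  obtain ⟨c, hc⟩ := mem_localRing_toBelyi.1 hφ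
  have := hasValueAt_twist hω ht hx hy hz hc
  rw [twist_belyiMap] at this
  exact mem_localRing_toBelyi.2 ⟨c, this⟩

lemma Related.toBelyi_eq {P Q : FermatCurve n} (h : Related k P Q) :
    toBelyi k P = toBelyi k Q :=
  belyi_ext (SetLike.ext fun _ => ⟨h.symm.mem_localRing, h.mem_localRing⟩)

end FermatCurve

/-! ### Invariant functions -/

namespace FermatCurve

open MvPolynomial (aeval eval)

variable {n k : ℕ} [NeZero n]

/-- K(x) contains y^k = v/x and y^n = 1 - x^n, hence y, as k and n are coprime. Since x is integral
over K, adjoining it as a ring already gives a field. -/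
lemma adjoin_x_eq_top (hn : 1 < n) (hcop : Nat.Coprime n k) :
    Algebra.adjoin (belyiMap n k).fieldRange {coords n 0} = ⊤ := by
  have hX0 : coords n 0 ≠ 0 := by simpa using coords_zero_ne (n := n) 0
  have hu : coords n 0 ^ n ∈ (belyiMap n k).fieldRange := ⟨_, belyiMap_u⟩
  have hint : IsIntegral (belyiMap n k).fieldRange (coords n 0) := by
    refine IsIntegral.of_pow (Nat.pos_of_ne_zero (NeZero.ne n)) ?_
    exact isIntegral_algebraMap (x := (⟨_, hu⟩ : (belyiMap n k).fieldRange))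
  rw [← IntermediateField.adjoin_simple_toSubalgebra_of_isAlgebraic hint.isAlgebraic]
  set E := IntermediateField.adjoin (belyiMap n k).fieldRange {coords n 0} with hE
  have hXE : coords n 0 ∈ E := IntermediateField.mem_adjoin_simple_self _ _
  have hrange : ∀ φ, belyiMap n k φ ∈ E := fun φ =>
    E.algebraMap_mem (⟨_, φ, rfl⟩ : (belyiMap n k).fieldRange)
  have hC : ∀ c : ℂ, algebraMap ℂ (FunctionField n) c ∈ E := fun c => by
    rw [← AlgHom.commutes (belyiMap n k)]
    exact hrange _
  have hYE : coords n 1 ∈ E := by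
    by_cases hY0 : coords n 1 = 0
    · rw [hY0]; exact zero_mem E
    have hYk : coords n 1 ^ k ∈ E := by
      have h1 := hrange (CyclicBelyi.v n k)
      rw [belyiMap_v] at h1
      rw [← inv_mul_cancel_left₀ hX0 (coords n 1 ^ k)]
      exact mul_mem (inv_mem hXE) h1
    have hYn : coords n 1 ^ n ∈ E := by
      rw [eq_sub_of_add_eq' (coords_pow (n := n))]
      exact sub_mem (one_mem E) (pow_mem hXE n)
    obtain ⟨m, -, hm⟩ := Nat.exists_mul_mod_eq_one_of_coprime hcop.symm hn
    have h2 : coords n 1 = (coords n 1 ^ k) ^ m * ((coords n 1 ^ n) ^ (k * m / n))⁻¹ := by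
      rw [eq_mul_inv_iff_mul_eq₀ (pow_ne_zero _ (pow_ne_zero _ hY0)), ← pow_mul, ← pow_mul]
      conv_rhs => rw [← Nat.div_add_mod (k * m) n, hm]
      rw [pow_succ, mul_comm]
    rw [h2]
    exact mul_mem (pow_mem hYk m) (inv_mem (pow_mem hYn _))
  refine eq_top_iff.2 fun f _ => ?_
  have hmem : ∀ p : MvPolynomial (Fin 3) ℂ, aeval (coords n) p ∈ E := by
    intro p
    induction p using MvPolynomial.induction_on with
    | C c => simpa using hC c
    | add p q hp hq => simpa using add_mem hp hq
    | mul_X p i hp =>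
      rw [map_mul, MvPolynomial.aeval_X]
      refine mul_mem hp ?_
      fin_cases i
      exacts [hXE, hYE, one_mem E]
  obtain ⟨p, q, hq, hpq⟩ := exists_eq_div f
  rw [eq_div_of_mul_eq hq hpq]
  exact (div_mem (hmem p) (hmem q) : _ ∈ E)

/-- The sum over the n powers of σ sends L into K, while it multiplies an invariant f by n, which is
invertible. -/
lemma mem_range_belyiMap_of_invariant (hn : 1 < n) (hcop : Nat.Coprime n k)
    {f : FunctionField n} (hf : twist k (zeta n) (zeta_pow n) f = f) :
    ∃ φ, belyiMap n k φ = f := by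
  set σ := twist k (zeta n) (zeta_pow n) with hσ
  set M := (belyiMap n k).fieldRange with hM
  have hu : coords n 0 ^ n ∈ M := ⟨_, belyiMap_u⟩
  have hσM : ∀ g ∈ M, ∀ j : ℕ, (σ ^ j) g = g := by
    rintro _ ⟨φ, rfl⟩ j
    induction j with
    | zero => rfl
    | succ j ih =>
      rw [pow_succ, AlgHom.mul_apply]
      exact (congrArg _ (twist_belyiMap (zeta_pow n) φ)).trans ih
  have hζ : IsPrimitiveRoot (zeta n : ℂ) n := Complex.isPrimitiveRoot_exp n (NeZero.ne n)
  obtain ⟨ρ, hρ, hρ'⟩ : ∃ ρ : ℂ, IsPrimitiveRoot ρ n ∧ σ (coords n 0) =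
      algebraMap ℂ _ ρ * coords n 0 :=
    ⟨_, (hζ.pow_of_coprime k hcop.symm).inv, twist_x _⟩
  have hσX : ∀ j : ℕ, (σ ^ j) (coords n 0) = algebraMap ℂ _ (ρ ^ j) * coords n 0 := by
    intro j
    induction j with
    | zero => simp
    | succ j ih =>
      rw [pow_succ, AlgHom.mul_apply, hρ', map_mul, ih, AlgHom.commutes, ← mul_assoc, ← map_mul,
        pow_succ, mul_comm ρ]
  have hsum : ∀ g : FunctionField n, ∑ j ∈ Finset.range n, (σ ^ j) g ∈ M := by
    intro g
    have hg : g ∈ Algebra.adjoin M {coords n 0} := by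
      rw [adjoin_x_eq_top hn hcop]; trivial
    obtain ⟨r, rfl⟩ := (Algebra.adjoin_singleton_eq_range_aeval M (coords n 0) ▸ hg :
      g ∈ (Polynomial.aeval (R := M) (coords n 0)).range)
    induction r using Polynomial.induction_on' with
    | add p q hp hq =>
      simp only [map_add, Finset.sum_add_distrib] at *
      exact add_mem (hp (by rw [adjoin_x_eq_top hn hcop]; trivial))
        (hq (by rw [adjoin_x_eq_top hn hcop]; trivial))
    | monomial i m =>
      have h1 : ∀ j ∈ Finset.range n, (σ ^ j) (Polynomial.aeval (coords n 0)
          (Polynomial.monomial i m)) =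
            (m : FunctionField n) * coords n 0 ^ i * algebraMap ℂ _ ((ρ ^ i) ^ j) := by
        intro j _
        rw [Polynomial.aeval_monomial, map_mul, map_pow, hσX, mul_pow, ← map_pow, ← pow_mul,
          mul_comm j i, pow_mul]
        have h2 : (σ ^ j) (algebraMap M _ m) = (m : FunctionField n) := hσM _ m.2 j
        rw [h2]
        ring
      refine (Finset.sum_congr rfl h1) ▸ ?_
      rw [← Finset.mul_sum, ← map_sum]
      -- The sum of m x^i over the powers of σ is m x^i times a geometric sum in ρ^i. It vanishes
      -- unless n divides i, and then x^i is a power of u.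
      by_cases hi : ρ ^ i = 1
      · obtain ⟨e, rfl⟩ := (hρ.pow_eq_one_iff_dvd i).1 hi
        refine mul_mem (mul_mem m.2 ?_) (M.algebraMap_mem _)
        rw [pow_mul]
        exact pow_mem hu e
      · rw [geom_sum_eq hi, ← pow_mul, mul_comm i, pow_mul, hρ.pow_eq_one, one_pow, sub_self,
          zero_div, map_zero, mul_zero]
        exact zero_mem M
  have hfix : ∀ j : ℕ, (σ ^ j) f = f := by
    intro j
    induction j with
    | zero => rfl
    | succ j ih => rw [pow_succ, AlgHom.mul_apply, hf, ih]
  have h3 := hsum f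
  simp only [hfix, Finset.sum_const, Finset.card_range, nsmul_eq_mul] at h3
  have hn0 : (n : FunctionField n) ≠ 0 := by
    rw [← map_natCast (algebraMap ℂ (FunctionField n))]
    exact (map_ne_zero _).2 (Nat.cast_ne_zero.2 (NeZero.ne n))
  have h4 : f ∈ M := by
    rw [← inv_mul_cancel_left₀ hn0 f]
    exact mul_mem (inv_mem (natCast_mem M n)) h3
  exact h4

lemma finite_hasValueAt_zero {f : FunctionField n} (hf : f ≠ 0) :
    {P : FermatCurve n | P.HasValueAt f 0}.Finite := by
  obtain ⟨p, q, hq, hpq⟩ := exists_eq_div f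
  obtain ⟨p', hp', hp''⟩ := MvPolynomial.exists_homogenization 2 p
    (le_max_left p.totalDegree q.totalDegree)
  obtain ⟨q', hq', hq''⟩ := MvPolynomial.exists_homogenization 2 q
    (le_max_right p.totalDegree q.totalDegree)
  rw [← hq'' _ _ coords_two] at hq hpq
  rw [← hp'' _ _ coords_two] at hpq
  have hp : aeval (coords n) p' ≠ 0 := by
    rw [← hpq]
    exact mul_ne_zero hf hq
  refine ((finite_zeros hp' hp).union (finite_zeros hq' hq)).subset fun P hP => ?_
  by_cases h : eval P.pt.rep q' = 0
  · exact .inr h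
  · left
    have h1 : P.HasValueAt f (eval P.pt.rep p' / eval P.pt.rep q') :=
      ⟨_, p', q', hp', hq', h, hpq, div_mul_cancel₀ _ h⟩
    exact (div_eq_zero_iff.1 (h1.unique hP)).resolve_right h

instance : Infinite (FermatCurve n) := by
  choose r hr using fun a : ℂ =>
    IsAlgClosed.exists_pow_nat_eq (1 - a ^ n) (Nat.pos_of_ne_zero (NeZero.ne n))
  let φ : ℂ → FermatCurve n := fun a => ofVec ![a, r a, 1]
    (fun h => by simpa using congrFun h 2) (by simp [hr])
  have hφ : ∀ a, (φ a).x / (φ a).z = a := by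
    intro a
    obtain ⟨t, ht, h⟩ := rep_ofVec (n := n) ![a, r a, 1]
      (fun h => by simpa using congrFun h 2) (by simp [hr])
    have h0 := h 0
    have h2 := h 2
    change (φ a).x = _ at h0
    change (φ a).z = _ at h2
    rw [h0, h2]
    simp [ht]
  exact Infinite.of_injective φ fun a b hab => by rw [← hφ a, hab, hφ b]

/-! ### The quotient map -/

lemma finite_fiber (R : CyclicBelyiCurve n k) :
    (toBelyi k ⁻¹' {R} : Set (FermatCurve n)).Finite := by
  obtain ⟨P, rfl⟩ := surjective_toBelyi n k R
  obtain ⟨φ, hφ0, hφ⟩ := exists_belyiMap_hasValueAt_zero k P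
  refine (finite_hasValueAt_zero (f := belyiMap n k φ) (by simpa using hφ0)).subset fun Q hQ => ?_
  rw [← hasValueAt_toBelyi] at hφ
  exact hasValueAt_toBelyi.1 ((show toBelyi k Q = toBelyi k P from hQ) ▸ hφ)

/-- Both topologies are cofinite, so this follows from surjectivity and finiteness of the fibres. -/
lemma isOpen_preimage_toBelyi {U : Set (CyclicBelyiCurve n k)} :
    IsOpen (toBelyi k ⁻¹' U : Set (FermatCurve n)) ↔ IsOpen U := by
  rw [isOpen_iff]
  change _ ↔ (U.Nonempty → Uᶜ.Finite)
  have hsurj := surjective_toBelyi n k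
  rw [← Set.preimage_compl]
  constructor
  · rintro h ⟨R, hR⟩
    obtain ⟨P, rfl⟩ := hsurj R
    rw [← Set.image_preimage_eq Uᶜ hsurj]
    exact (h ⟨P, hR⟩).image _
  · rintro h ⟨P, hP⟩
    exact (h ⟨_, hP⟩).preimage' fun R _ => finite_fiber R

lemma isOpen_image_toBelyi {V : Set (FermatCurve n)} (hV : IsOpen V) :
    IsOpen (toBelyi k '' V) := by
  rintro ⟨_, P, hP, rfl⟩
  refine ((isOpen_iff.1 hV ⟨P, hP⟩).image (toBelyi k)).subset fun R hR => ?_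
  obtain ⟨Q, rfl⟩ := surjective_toBelyi n k R
  exact ⟨Q, fun hQ => hR ⟨Q, hQ, rfl⟩, rfl⟩

lemma isRegularOn_comp_toBelyi {U : Set (CyclicBelyiCurve n k)} {f : CyclicBelyiCurve n k → ℂ}
    (hf : CyclicBelyiCurve.IsRegularOn U f) : IsRegularOn (toBelyi k ⁻¹' U) (f ∘ toBelyi k) := by
  intro P hP
  obtain ⟨V, hV, hPV, hVU, φ, hφ⟩ := hf _ hP
  obtain ⟨d, p, q, hp, hq, hqP, hpq, -⟩ := hasValueAt_toBelyi.1 (hφ _ hPV)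
  refine ⟨toBelyi k ⁻¹' V ∩ {Q | eval Q.pt.rep q ≠ 0},
    (isOpen_preimage_toBelyi.2 hV).inter (isOpen_setOf_eval_ne_zero hq), ⟨hPV, hqP⟩,
    fun Q hQ => hVU hQ.1, d, p, q, hp, hq, fun Q hQ => ⟨hQ.2, ?_⟩⟩
  exact (hasValueAt_toBelyi.1 (hφ _ hQ.1)).unique
    ⟨d, p, q, hp, hq, hQ.2, hpq, div_mul_cancel₀ _ hQ.2⟩

/-- Where both P and τP lie in V, a and its twist take the same value at P, because π(P) = π(τP).
The set of such P is cofinite in an infinite curve, whereas a nonzero function has finitely many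
zeros. -/
lemma twist_eq_self_of_hasValueAt {V : Set (FermatCurve n)} (hV : IsOpen V) (hne : V.Nonempty)
    {a : FunctionField n} {f : CyclicBelyiCurve n k → ℂ}
    (h : ∀ Q ∈ V, Q.HasValueAt a (f (toBelyi k Q))) {ω : ℂˣ} (hω : ω ^ n = 1) :
    twist k ω hω a = a := by
  by_contra hcon
  have hb : ∀ i, (![1, ω ^ (k + 1), ω ^ k] : Fin 3 → ℂˣ) i ^ n = 1 := by
    have h1 : ∀ j, (ω ^ j) ^ n = 1 := fun j => by rw [← pow_mul, mul_comm, pow_mul, hω, one_pow]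
    intro i
    fin_cases i
    exacts [one_pow n, h1 _, h1 _]
  let τ : FermatCurve n ≃ FermatCurve n := (scaleAut _ hb).1
  have hV' : Vᶜ.Finite := isOpen_iff.1 hV hne
  have hfin : (Vᶜ ∪ τ ⁻¹' Vᶜ ∪ {P | P.HasValueAt (twist k ω hω a - a) 0}).Finite :=
    (hV'.union (hV'.preimage τ.injective.injOn)).union
      (finite_hasValueAt_zero (sub_ne_zero.2 hcon))
  obtain ⟨P, hP⟩ := hfin.infinite_compl.nonempty
  simp only [Set.mem_compl_iff, Set.mem_union, Set.mem_preimage, not_or, not_not] at hP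
  obtain ⟨⟨h1, h2⟩, h3⟩ := hP
  refine h3 ?_
  obtain ⟨t, ht⟩ := exists_rep_map_diag ![1, ω ^ (k + 1), ω ^ k] P.pt
  have hx : (τ P).x = t * P.x := (congrFun ht 0).trans (by simp [x])
  have hy : (τ P).y = t * ((ω : ℂ) ^ (k + 1) * P.y) := (congrFun ht 1).trans (by simp [y])
  have hz : (τ P).z = t * ((ω : ℂ) ^ k * P.z) := (congrFun ht 2).trans (by simp [z])
  have hrel : toBelyi k P = toBelyi k (τ P) :=
    Related.toBelyi_eq ⟨ω, hω, t, t.ne_zero, hx, hy, hz⟩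
  have h4 := hasValueAt_twist hω t.ne_zero hx hy hz (h _ h2)
  rw [← hrel] at h4
  simpa using h4.sub (h _ h1)

/-- A local fraction for f ∘ π need not be defined on an invariant open set, but as an element of
the function field it is invariant. It therefore comes from a φ, which represents f on the open
image of V. -/
lemma isRegularOn_of_comp_toBelyi (hn : 1 < n) (hcop : Nat.Coprime n k)
    {U : Set (CyclicBelyiCurve n k)} {f : CyclicBelyiCurve n k → ℂ}
    (hf : IsRegularOn (toBelyi k ⁻¹' U) (f ∘ toBelyi k)) : CyclicBelyiCurve.IsRegularOn U f := by
  intro R hR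
  obtain ⟨P, rfl⟩ := surjective_toBelyi n k R
  obtain ⟨V, hV, hPV, hVU, d, p, q, hp, hq, hpq⟩ := hf P hR
  have hq0 : aeval (coords n) q ≠ 0 := fun h0 => (hpq P hPV).1 (eval_rep_eq_zero hq h0 P)
  have hval : ∀ Q ∈ V, Q.HasValueAt (aeval (coords n) p / aeval (coords n) q)
      (f (toBelyi k Q)) := fun Q hQ =>
    ⟨d, p, q, hp, hq, (hpq Q hQ).1, div_mul_cancel₀ _ hq0, by
      rw [← div_mul_cancel₀ (eval Q.pt.rep p) (hpq Q hQ).1, ← (hpq Q hQ).2]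
      rfl⟩
  obtain ⟨φ, hφ⟩ := mem_range_belyiMap_of_invariant hn hcop
    (twist_eq_self_of_hasValueAt hV ⟨P, hPV⟩ hval (zeta_pow n))
  refine ⟨toBelyi k '' V, isOpen_image_toBelyi hV, ⟨P, hPV, rfl⟩,
    Set.image_subset_iff.2 hVU, φ, ?_⟩
  rintro _ ⟨Q, hQ, rfl⟩
  rw [hasValueAt_toBelyi, hφ]
  exact hval Q hQ

lemma isQuotientBy_toBelyi (hn : 1 < n) (hcop : Nat.Coprime n (k * (k + 1))) :
    SpaceWithFunctions.IsQuotientBy (H n k) (toBelyi (n := n) k) where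
  isQuotientMap := (Topology.isQuotientMap_iff _).2
    ⟨Topology.isCoinducing_iff.2 fun _ => isOpen_preimage_toBelyi, surjective_toBelyi n k⟩
  eq_iff P Q := by
    rw [exists_mem_H_iff (Nat.Coprime.coprime_mul_right_right hcop)]
    exact ⟨related_of_toBelyi_eq hn hcop, Related.toBelyi_eq⟩
  isRegularOn_iff U f _ := ⟨isRegularOn_comp_toBelyi,
    isRegularOn_of_comp_toBelyi hn (Nat.Coprime.coprime_mul_right_right hcop)⟩

/-! ### The three special fibres -/

lemma ncard_setOf_pow_eq {c : ℂ} (hc : c ≠ 0) : {ξ : ℂ | ξ ^ n = c}.ncard = n := by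
  classical
  have hζ := Complex.isPrimitiveRoot_exp n (NeZero.ne n)
  have h : {ξ : ℂ | ξ ^ n = c} = (Polynomial.nthRoots n c).toFinset := by
    ext ξ
    simp [Polynomial.mem_nthRoots (Nat.pos_of_ne_zero (NeZero.ne n))]
  rw [h, Set.ncard_coe_finset, Multiset.toFinset_card_of_nodup (hζ.nthRoots_nodup hc),
    hζ.card_nthRoots, if_pos (IsAlgClosed.exists_pow_nat_eq c (Nat.pos_of_ne_zero (NeZero.ne n)))]

omit [NeZero n] in
lemma exists_coords_eq (w : Fin 3 → ℂ) (hw : w ≠ 0) (h : w 0 ^ n + w 1 ^ n = w 2 ^ n) :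
    ∃ (P : FermatCurve n) (t : ℂ), t ≠ 0 ∧ P.x = t * w 0 ∧ P.y = t * w 1 ∧ P.z = t * w 2 := by
  obtain ⟨t, ht, hrep⟩ := rep_ofVec w hw h
  exact ⟨ofVec w hw h, t, ht, hrep 0, hrep 1, hrep 2⟩

lemma exists_z_eq_zero {ξ : ℂ} (hξ : ξ ^ n = -1) :
    ∃ P : FermatCurve n, P.z = 0 ∧ P.y / P.x = ξ := by
  obtain ⟨P, t, ht, hx, hy, hz⟩ := exists_coords_eq (n := n) ![1, ξ, 0]
    (fun h => by simpa using congrFun h 0) (by simp [hξ, NeZero.ne n])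
  exact ⟨P, by simpa using hz, by rw [hx, hy]; simp [ht]⟩

lemma exists_x_eq_zero {ξ : ℂ} (hξ : ξ ^ n = 1) :
    ∃ P : FermatCurve n, (P.z ≠ 0 ∧ P.x = 0) ∧ P.y / P.z = ξ := by
  obtain ⟨P, t, ht, hx, hy, hz⟩ := exists_coords_eq (n := n) ![0, ξ, 1]
    (fun h => by simpa using congrFun h 2) (by simp [hξ, NeZero.ne n])
  exact ⟨P, ⟨by rw [hz]; simpa using ht, by simpa using hx⟩, by rw [hy, hz]; simp [ht]⟩

lemma exists_y_eq_zero {ξ : ℂ} (hξ : ξ ^ n = 1) :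
    ∃ P : FermatCurve n, (P.z ≠ 0 ∧ P.y = 0) ∧ P.x / P.z = ξ := by
  obtain ⟨P, t, ht, hx, hy, hz⟩ := exists_coords_eq (n := n) ![ξ, 0, 1]
    (fun h => by simpa using congrFun h 2) (by simp [hξ, NeZero.ne n])
  exact ⟨P, ⟨by rw [hz]; simpa using ht, by simpa using hy⟩, by rw [hx, hz]; simp [ht]⟩

lemma ncard_z_eq_zero : {P : FermatCurve n | P.z = 0}.ncard = n := by
  have himg : (fun P : FermatCurve n => P.y / P.x) '' {P | P.z = 0} = {ξ : ℂ | ξ ^ n = -1} := by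
    ext ξ
    constructor
    · rintro ⟨P, hP, rfl⟩
      exact div_x_pow hP
    · exact exists_z_eq_zero
  have hinj : Set.InjOn (fun P : FermatCurve n => P.y / P.x) {P | P.z = 0} :=
    fun P hP Q hQ => eq_of_div_x hP hQ
  rw [← hinj.ncard_image, himg, ncard_setOf_pow_eq (by norm_num)]

lemma ncard_x_eq_zero : {P : FermatCurve n | P.z ≠ 0 ∧ P.x = 0}.ncard = n := by
  have himg : (fun P : FermatCurve n => P.y / P.z) '' {P | P.z ≠ 0 ∧ P.x = 0} =
      {ξ : ℂ | ξ ^ n = 1} := by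
    ext ξ
    constructor
    · rintro ⟨P, ⟨hz, hx⟩, rfl⟩
      have h := div_z_pow hz
      rwa [hx, zero_div, zero_pow (NeZero.ne n), zero_add] at h
    · exact exists_x_eq_zero
  have hinj : Set.InjOn (fun P : FermatCurve n => P.y / P.z) {P | P.z ≠ 0 ∧ P.x = 0} :=
    fun P hP Q hQ => eq_of_div_z hP.1 hQ.1 (by rw [hP.2, hQ.2, zero_div, zero_div])
  rw [← hinj.ncard_image, himg, ncard_setOf_pow_eq one_ne_zero]

lemma ncard_y_eq_zero : {P : FermatCurve n | P.z ≠ 0 ∧ P.y = 0}.ncard = n := by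
  have himg : (fun P : FermatCurve n => P.x / P.z) '' {P | P.z ≠ 0 ∧ P.y = 0} =
      {ξ : ℂ | ξ ^ n = 1} := by
    ext ξ
    constructor
    · rintro ⟨P, ⟨hz, hy⟩, rfl⟩
      have h := div_z_pow hz
      rwa [hy, zero_div, zero_pow (NeZero.ne n), add_zero] at h
    · exact exists_y_eq_zero
  have hinj : Set.InjOn (fun P : FermatCurve n => P.x / P.z) {P | P.z ≠ 0 ∧ P.y = 0} :=
    fun P hP Q hQ h => eq_of_div_z hP.1 hQ.1 h (by rw [hP.2, hQ.2, zero_div, zero_div])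
  rw [← hinj.ncard_image, himg, ncard_setOf_pow_eq one_ne_zero]

lemma hasValueAt_zero_zero_iff {P : FermatCurve n} :
    (toBelyi k P).HasValueAt (CyclicBelyi.u n k) 0 ∧
      (toBelyi k P).HasValueAt (CyclicBelyi.v n k) 0 ↔ P.z ≠ 0 ∧ P.x = 0 := by
  constructor
  · rintro ⟨hu, -⟩
    have hz : P.z ≠ 0 := fun hz => u_notMem hz hu.mem
    have h := belyi_hasValueAt_unique (hasValueAt_u hz) hu
    exact ⟨hz, (div_eq_zero_iff.1 (eq_zero_of_pow_eq_zero h)).resolve_right hz⟩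
  · rintro ⟨hz, hx⟩
    have hu := hasValueAt_u (k := k) hz
    have hv := hasValueAt_v (k := k) hz
    rw [hx, zero_div] at hu hv
    rw [zero_pow (NeZero.ne n)] at hu
    rw [zero_mul] at hv
    exact ⟨hu, hv⟩

lemma hasValueAt_one_zero_iff (hk : k ≠ 0) {P : FermatCurve n} :
    (toBelyi k P).HasValueAt (CyclicBelyi.u n k) 1 ∧
      (toBelyi k P).HasValueAt (CyclicBelyi.v n k) 0 ↔ P.z ≠ 0 ∧ P.y = 0 := by
  constructor
  · rintro ⟨hu, -⟩
    have hz : P.z ≠ 0 := fun hz => u_notMem hz hu.mem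
    have h := belyi_hasValueAt_unique (hasValueAt_u hz) hu
    have h1 : (P.y / P.z) ^ n = 0 := by linear_combination div_z_pow hz - h
    exact ⟨hz, (div_eq_zero_iff.1 (eq_zero_of_pow_eq_zero h1)).resolve_right hz⟩
  · rintro ⟨hz, hy⟩
    have hu := hasValueAt_u (k := k) hz
    have hv := hasValueAt_v (k := k) hz
    have h1 := div_z_pow hz
    rw [hy, zero_div, zero_pow (NeZero.ne n), add_zero] at h1
    rw [h1] at hu
    rw [hy, zero_div, zero_pow hk, mul_zero] at hv
    exact ⟨hu, hv⟩

/-- A point of the Belyi curve is determined by a property that defines a single orbit. -/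
lemma toBelyi_eq_iff {p : CyclicBelyiCurve n k → Prop} {q : FermatCurve n → Prop}
    (hpq : ∀ P, p (toBelyi k P) ↔ q P) (hq : ∀ P Q, q P → q Q → Related k P Q)
    {P : FermatCurve n} (hP : q P) (R : CyclicBelyiCurve n k) : R = toBelyi k P ↔ p R := by
  constructor
  · rintro rfl
    exact (hpq P).2 hP
  · obtain ⟨Q, rfl⟩ := surjective_toBelyi n k R
    intro h
    exact (hq _ _ ((hpq Q).1 h) hP).toBelyi_eq

end FermatCurve

end

/-! ### The quotient map and its three special fibres -/

theorem lemma2p3 (n k : ℕ) [NeZero n] (hn : 3 ≤ n) (hk : 1 ≤ k) (hkn : k + 2 ≤ n)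
    (hcop : Nat.Coprime n (k * (k + 1))) :
    ∃ η₀ η₁ ηinf : CyclicBelyiCurve n k,
      -- `η₀` is the point `(0, 0)`, `η₁` is the point `(1, 0)`, and `ηinf` is the unique point
      -- that is not on the affine chart
      (∀ R : CyclicBelyiCurve n k,
        R = η₀ ↔ R.HasValueAt (CyclicBelyi.u n k) 0 ∧ R.HasValueAt (CyclicBelyi.v n k) 0) ∧
      (∀ R : CyclicBelyiCurve n k,
        R = η₁ ↔ R.HasValueAt (CyclicBelyi.u n k) 1 ∧ R.HasValueAt (CyclicBelyi.v n k) 0) ∧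
      (∀ R : CyclicBelyiCurve n k, R = ηinf ↔ ¬ R.OnAffineChart) ∧
      ∃ π : FermatCurve n → CyclicBelyiCurve n k,
        SpaceWithFunctions.IsQuotientBy (FermatCurve.H n k) π ∧
        -- `u = x ^ n` and `v = x y ^ k` in the affine coordinates `x / z`, `y / z`
        (∀ P : FermatCurve n, P.z ≠ 0 →
          (π P).HasValueAt (CyclicBelyi.u n k) ((P.x / P.z) ^ n) ∧
          (π P).HasValueAt (CyclicBelyi.v n k) (P.x / P.z * (P.y / P.z) ^ k)) ∧
        -- the fibres over the three points, each of which consists of `n` points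
        (π ⁻¹' {ηinf} = {P | P.z = 0} ∧ {P : FermatCurve n | P.z = 0}.ncard = n) ∧
        (π ⁻¹' {η₀} = {P | P.z ≠ 0 ∧ P.x = 0} ∧
          {P : FermatCurve n | P.z ≠ 0 ∧ P.x = 0}.ncard = n) ∧
        (π ⁻¹' {η₁} = {P | P.z ≠ 0 ∧ P.y = 0} ∧
          {P : FermatCurve n | P.z ≠ 0 ∧ P.y = 0}.ncard = n) := by
  have hn1 : 1 < n := by omega
  have hk0 : k ≠ 0 := by omega
  have hck : Nat.Coprime n k := Nat.Coprime.coprime_mul_right_right hcop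
  have hck1 : Nat.Coprime n (k + 1) := Nat.Coprime.coprime_mul_left_right hcop
  obtain ⟨P₀, hP₀, -⟩ := FermatCurve.exists_x_eq_zero (n := n) (one_pow n)
  obtain ⟨P₁, hP₁, -⟩ := FermatCurve.exists_y_eq_zero (n := n) (one_pow n)
  obtain ⟨ξ, hξ⟩ := IsAlgClosed.exists_pow_nat_eq (-1 : ℂ) (Nat.pos_of_ne_zero (NeZero.ne n))
  obtain ⟨Pinf, hPinf, -⟩ := FermatCurve.exists_z_eq_zero (n := n) hξ
  have h₀ := FermatCurve.toBelyi_eq_iff (k := k) (p := fun R => R.HasValueAt (CyclicBelyi.u n k) 0 ∧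
    R.HasValueAt (CyclicBelyi.v n k) 0) (fun _ => FermatCurve.hasValueAt_zero_zero_iff)
    (fun P Q hP hQ => FermatCurve.related_of_x_eq_zero hP.1 hQ.1 hP.2 hQ.2) hP₀
  have h₁ := FermatCurve.toBelyi_eq_iff (k := k) (p := fun R => R.HasValueAt (CyclicBelyi.u n k) 1 ∧
    R.HasValueAt (CyclicBelyi.v n k) 0) (fun _ => FermatCurve.hasValueAt_one_zero_iff hk0)
    (fun P Q hP hQ => FermatCurve.related_of_y_eq_zero hn1 hck hP.1 hQ.1 hP.2 hQ.2) hP₁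
  have hinf := FermatCurve.toBelyi_eq_iff (k := k) (p := fun R => ¬ R.OnAffineChart)
    (fun P => FermatCurve.onAffineChart_toBelyi.not.trans not_not)
    (fun P Q hP hQ => FermatCurve.related_of_z_eq_zero hn1 hck1 hP hQ) hPinf
  refine ⟨FermatCurve.toBelyi k P₀, FermatCurve.toBelyi k P₁, FermatCurve.toBelyi k Pinf,
    h₀, h₁, hinf, FermatCurve.toBelyi k, FermatCurve.isQuotientBy_toBelyi hn1 hcop,
    fun P hP => ⟨FermatCurve.hasValueAt_u hP, FermatCurve.hasValueAt_v hP⟩,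
    ⟨?_, FermatCurve.ncard_z_eq_zero⟩, ⟨?_, FermatCurve.ncard_x_eq_zero⟩, ⟨?_, FermatCurve.ncard_y_eq_zero⟩⟩
  · ext P
    exact (hinf _).trans (FermatCurve.onAffineChart_toBelyi.not.trans not_not)
  · ext P
    exact (h₀ _).trans FermatCurve.hasValueAt_zero_zero_iff
  · ext P
    exact (h₁ _).trans (FermatCurve.hasValueAt_one_zero_iff hk0)
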